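/- Let $F:\mathbb R\to\mathbb R$ be $2\pi$-periodic and smooth on a non-empty open set $D\subseteq\mathbb R$. In Euclidean space $\mathbb E_3$ with Cartesian coordinates $(x,y,z)$ and cylindrical coordinates $(r,\psi,z)$ around the $z$-axis, let $\Omega$ be the open set of points with $r>0$ having an angle $\psi\in D$. On $\Omega\times\mathbb R^3$ let $$\begin{aligned} H=H_0&=\tfrac12\Big(p_r^2+\tfrac1{r^2}p_\psi^2+p_z^2\Big)+\tfrac{F(\psi)}{r^2},\qquad H_1=\tfrac12p_\psi^2+F(\psi),\qquad H_2=\tfrac12p_z^2,\\ H_3&=\tfrac12\Big[(rp_z-zp_r)^2+\Big(1+\tfrac{z^2}{r^2}\Big)p_\psi^2\Big]+\Big(1+\tfrac{z^2}{r^2}\Big)F(\psi),\\ H_4&=\tfrac12\Big(zp_r^2+\tfrac z{r^2}p_\psi^2-rp_rp_z\Big)+\tfrac z{r^2}F(\psi). \end{aligned}$$ Then: 1. Each $H_k$ is a first integral of $H$ (that is, $\{H,H_k\}=0$) and has the form $H_k=\tfrac12K_k^{ij}p_ip_j+V_k$ with $\mathbf K_k$ a symmetric Killing two-tensor of $\mathbb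 E_3$ and $V_k$ a function on $\Omega$ ($\mathbf K_0$ is the metric and $V_0=V=F(\psi)/r^2$). 2. Let $\hat H_k\phi=\tfrac12\nabla_i(K_k^{ij}\nabla_j\phi)+V_k\phi$ for smooth $\phi:\Omega\to\mathbb C$, so that $\hat H=\hat H_0=\tfrac12\Delta+F(\psi)/r^2$ is the Schrödinger operator associated to $H$. The operators $\hat H_1,\dots,\hat H_4$ are four distinct second order symmetry operators of $\hat H$: each has order exactly two and commutes with $\hat H$ on the smooth functions on $\Omega$, and $\hat H,\hat H_1,\dots,\hat H_4$ are linearly independent. 3. $\hat H$ is multiplicatively separable in the five rotational orthogonal webs around the $z$-axis: circular cylindrical, spherical, parabolic, prolate spheroidal and oblate spheroidal (the last two for every focal parameter $a>0$). That is, in each of these orthogonal coordinate systems $(q^1,q^2,q^3)$, with $q^3=\psi$ restricted to $D$, for every open coordinate box $B$ on which the coordinate map is injective, every $q_0\in B$ and all $u,v\in\mathbb C^3$ there are $E\in\mathbb C$ and smooth one-variable functions $f_i$ with $f_i(q_0^i)=1$, $f_i'(q_0^i)=u_i$, $f_i''(q_0^i)=v_i$ such that $\phi=f_1(q^1)f_2(q^2)f_3(q^3)$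 is smooth and solves $\hat H\phi=E\phi$ on the part of $\Omega$ parametrized by $B$. The five webs are distinct: no similarity of $\mathbb E_3$ carries the set of coordinate surfaces of one type onto that of another, whatever the values of the focal parameters. -/

import Mathlib

open scoped ContDiff

/-- Euclidean three-space, with Cartesian coordinates `x 0, x 1, x 2`. -/
abbrev E3 : Type := EuclideanSpace ℝ (Fin 3)

/-- The Cartesian partial derivative in the `i`-th direction. -/
noncomputable def pd {G : Type*} [NormedAddCommGroup G] [NormedSpace ℝ G]
    (i : Fin 3) (f : E3 → G) (x : E3) : G :=
  fderiv ℝ f x (EuclideanSpace.single i 1)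

/-- The distance `r` from the `z`-axis. -/
noncomputable def rad (x : E3) : ℝ := √(x 0 ^ 2 + x 1 ^ 2)

/-- The angle of rotation `ψ` around the `z`-axis, normalised to `(-π, π]`. -/
noncomputable def ang (x : E3) : ℝ := Complex.arg (⟨x 0, x 1⟩ : ℂ)

/-- The point of space with cylindrical coordinates `(r, ψ, z)`. -/
noncomputable def cyl (r ψ z : ℝ) : E3 := !₂[r * Real.cos ψ, r * Real.sin ψ, z]

/-- The region off the `z`-axis whose points have an angle in `D`. -/
def region (D : Set ℝ) : Set E3 :=
  {x | ∃ r ψ z : ℝ, 0 < r ∧ ψ ∈ D ∧ x = cyl r ψ z}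

/-- The radial momentum `p_r`. -/
noncomputable def momR (x p : E3) : ℝ := (x 0 * p 0 + x 1 * p 1) / rad x

/-- The angular momentum `p_ψ`. -/
noncomputable def momPsi (x p : E3) : ℝ := x 0 * p 1 - x 1 * p 0

/-- The Hamiltonian `H = H_0` and the quadratic first integrals `H_1, …, H_4`, as functions of
position and momentum written in cylindrical variables. -/
noncomputable def firstIntegral (F : ℝ → ℝ) : Fin 5 → E3 → E3 → ℝ :=
  ![fun x p => 1 / 2 * (momR x p ^ 2 + 1 / rad x ^ 2 * momPsi x p ^ 2 + p 2 ^ 2)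
      + F (ang x) / rad x ^ 2,
    fun x p => 1 / 2 * momPsi x p ^ 2 + F (ang x),
    fun _ p => 1 / 2 * p 2 ^ 2,
    fun x p => 1 / 2 * ((rad x * p 2 - x 2 * momR x p) ^ 2
        + (1 + x 2 ^ 2 / rad x ^ 2) * momPsi x p ^ 2)
      + (1 + x 2 ^ 2 / rad x ^ 2) * F (ang x),
    fun x p => 1 / 2 * (x 2 * momR x p ^ 2 + x 2 / rad x ^ 2 * momPsi x p ^ 2
        - rad x * momR x p * p 2)
      + x 2 / rad x ^ 2 * F (ang x)]

/-- The Cartesian components of the Killing tensors `K_0, …, K_4` (`K_0` is the metric). -/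
noncomputable def killing : Fin 5 → E3 → Matrix (Fin 3) (Fin 3) ℝ :=
  ![fun _ => 1,
    fun x => !![x 1 ^ 2, -(x 0 * x 1), 0; -(x 0 * x 1), x 0 ^ 2, 0; 0, 0, 0],
    fun _ => !![0, 0, 0; 0, 0, 0; 0, 0, 1],
    fun x => !![x 1 ^ 2 + x 2 ^ 2, -(x 0 * x 1), -(x 0 * x 2);
                -(x 0 * x 1), x 0 ^ 2 + x 2 ^ 2, -(x 1 * x 2);
                -(x 0 * x 2), -(x 1 * x 2), x 0 ^ 2 + x 1 ^ 2],
    fun x => !![x 2, 0, -(x 0 / 2); 0, x 2, -(x 1 / 2); -(x 0 / 2), -(x 1 / 2), 0]]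

/-- The scalar parts `V_0 = V, V_1, …, V_4` of the first integrals. -/
noncomputable def pot (F : ℝ → ℝ) : Fin 5 → E3 → ℝ :=
  ![fun x => F (ang x) / rad x ^ 2,
    fun x => F (ang x),
    fun _ => 0,
    fun x => (1 + x 2 ^ 2 / rad x ^ 2) * F (ang x),
    fun x => x 2 / rad x ^ 2 * F (ang x)]

/-- `K` is a symmetric Killing two-tensor of Euclidean space. -/
def IsKillingTensor (K : E3 → Matrix (Fin 3) (Fin 3) ℝ) : Prop :=
  (∀ i j : Fin 3, ContDiff ℝ ∞ fun x => K x i j) ∧ (∀ x, (K x).IsSymm) ∧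
    ∀ x (i j k : Fin 3),
      pd i (fun y => K y j k) x + pd j (fun y => K y k i) x + pd k (fun y => K y i j) x = 0

/-- The canonical Poisson bracket of two functions of position and momentum. -/
noncomputable def poisson (f g : E3 → E3 → ℝ) (x p : E3) : ℝ :=
  ∑ i : Fin 3, (pd i (fun y => f y p) x * pd i (g x) p - pd i (f x) p * pd i (fun y => g y p) x)

/-- The operator `φ ↦ ½ ∇_i (K^{ij} ∇_j φ) + W φ` on wave functions. -/
noncomputable def quantize (K : E3 → Matrix (Fin 3) (Fin 3) ℝ) (W : E3 → ℝ)
    (φ : E3 → ℂ) (x : E3) : ℂ :=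
  1 / 2 * ∑ i : Fin 3, ∑ j : Fin 3, pd i (fun y => (K y i j : ℂ) * pd j φ y) x + (W x : ℂ) * φ x

/-- The quantum operators: `qop F 0` is the Schrödinger operator `½ Δ + V`, and `qop F k` is
the operator obtained from the Killing tensor and scalar part of the `k`-th first integral. -/
noncomputable def qop (F : ℝ → ℝ) (k : Fin 5) : (E3 → ℂ) → E3 → ℂ :=
  quantize (killing k) (pot F k)

/-- The operators `S` and `T` commute on the smooth wave functions on `Ω`. -/
def CommuteOn (Ω : Set E3) (S T : (E3 → ℂ) → E3 → ℂ) : Prop :=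
  ∀ φ : E3 → ℂ, ContDiffOn ℝ ∞ φ Ω → ∀ x ∈ Ω, S (T φ) x = T (S φ) x

/-- On `Ω`, `T` is a linear differential operator of order two (and not of lower order). -/
def IsSecondOrderOn (Ω : Set E3) (T : (E3 → ℂ) → E3 → ℂ) : Prop :=
  (∃ (A : Fin 3 → Fin 3 → E3 → ℂ) (b : Fin 3 → E3 → ℂ) (c : E3 → ℂ),
    ∀ φ : E3 → ℂ, ContDiffOn ℝ ∞ φ Ω → ∀ x ∈ Ω,
      T φ x = ∑ i, ∑ j, A i j x * pd i (pd j φ) x + ∑ i, b i x * pd i φ x + c x * φ x) ∧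
  ¬ ∃ (b : Fin 3 → E3 → ℂ) (c : E3 → ℂ),
    ∀ φ : E3 → ℂ, ContDiffOn ℝ ∞ φ Ω → ∀ x ∈ Ω,
      T φ x = ∑ i, b i x * pd i φ x + c x * φ x

/-- A family of operators is linearly independent on the smooth wave functions on `Ω`. -/
def LinIndepOn {n : ℕ} (Ω : Set E3) (T : Fin n → (E3 → ℂ) → E3 → ℂ) : Prop :=
  ∀ c : Fin n → ℂ,
    (∀ φ : E3 → ℂ, ContDiffOn ℝ ∞ φ Ω → ∀ x ∈ Ω, ∑ k, c k * T k φ x = 0) → c = 0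

/-- The five types of rotational separable webs. -/
inductive RotWeb : Type
  | cylindrical
  | spherical
  | parabolic
  | prolate
  | oblate

/-- Range of the two non-angular coordinates of a rotational coordinate system. -/
def RotWeb.dom : RotWeb → Set (ℝ × ℝ)
  | .cylindrical => {s | 0 < s.1}
  | .spherical => {s | 0 < s.1 ∧ s.2 ∈ Set.Ioo 0 Real.pi}
  | .parabolic => {s | 0 < s.1 ∧ 0 < s.2}
  | .prolate => {s | 0 < s.1 ∧ s.2 ∈ Set.Ioo 0 Real.pi}
  | .oblate => {s | 0 < s.1 ∧ s.2 ∈ Set.Ioo 0 Real.pi}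

/-- Distance from the axis, as a function of the non-angular coordinates; `a` is the focal
half-distance (prolate) or focal radius (oblate), and is not used by the other types. -/
noncomputable def RotWeb.radial (a : ℝ) : RotWeb → ℝ → ℝ → ℝ
  | .cylindrical, s, _ => s
  | .spherical, s, t => s * Real.sin t
  | .parabolic, s, t => s * t
  | .prolate, s, t => a * Real.sinh s * Real.sin t
  | .oblate, s, t => a * Real.cosh s * Real.sin t

/-- Height along the axis, as a function of the non-angular coordinates. -/
noncomputable def RotWeb.height (a : ℝ) : RotWeb → ℝ → ℝ → ℝ
  | .cylindrical, _, t => t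
  | .spherical, s, t => s * Real.cos t
  | .parabolic, s, t => (s ^ 2 - t ^ 2) / 2
  | .prolate, s, t => a * Real.cosh s * Real.cos t
  | .oblate, s, t => a * Real.sinh s * Real.cos t

/-- The coordinate map `(q¹, q², q³) ↦ (x, y, z)`, with angle of rotation `q³`. -/
noncomputable def RotWeb.coord (w : RotWeb) (a : ℝ) (q : Fin 3 → ℝ) : E3 :=
  cyl (w.radial a (q 0) (q 1)) (q 2) (w.height a (q 0) (q 1))

/-- The coordinate domain, with the angle restricted to `D`. -/
def RotWeb.coordDom (w : RotWeb) (D : Set ℝ) : Set (Fin 3 → ℝ) :=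
  {q | (q 0, q 1) ∈ w.dom ∧ q 2 ∈ D}

/-- The web: the set of all coordinate surfaces `qⁱ = const`. -/
def RotWeb.surfaces (w : RotWeb) (a : ℝ) : Set (Set E3) :=
  {S | S.Nonempty ∧ ∃ (i : Fin 3) (c : ℝ),
    S = w.coord a '' {q | q ∈ w.coordDom Set.univ ∧ q i = c}}

/-- Two sets of surfaces are equivalent if a similarity of space carries one to the other. -/
def WebEquiv (𝒮 𝒯 : Set (Set E3)) : Prop :=
  ∃ Φ : E3 ≃ᵈ E3, (fun S : Set E3 => Φ '' S) '' 𝒮 = 𝒯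

/-- `X` is a smooth map with nowhere vanishing, mutually orthogonal coordinate vector fields
on the open set `Q`, i.e. it defines orthogonal coordinates locally. -/
def IsOrthogonalCoords (X : (Fin 3 → ℝ) → E3) (Q : Set (Fin 3 → ℝ)) : Prop :=
  IsOpen Q ∧ ContDiffOn ℝ ∞ X Q ∧ ∀ q ∈ Q,
    (∀ i : Fin 3, fderiv ℝ X q (Pi.single i 1) ≠ 0) ∧
    ∀ i j : Fin 3, i ≠ j →
      inner ℝ (fderiv ℝ X q (Pi.single i 1)) (fderiv ℝ X q (Pi.single j 1)) = 0

/-- Multiplicative separability of the eigenvalue equation `T φ = E φ` in the coordinates `X`: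
on every coordinate box it has a complete separated solution `∏ fᵢ(qⁱ)`, i.e. a family of
separated solutions depending on `2 · 3` independent constants, namely the arbitrarily
assigned values `uᵢ = fᵢ'/fᵢ` and `vᵢ = fᵢ''/fᵢ` at a point of the box. -/
def MultiplicativelySeparable (T : (E3 → ℂ) → E3 → ℂ) (X : (Fin 3 → ℝ) → E3)
    (Q : Set (Fin 3 → ℝ)) : Prop :=
  ∀ I : Fin 3 → Set ℝ, (∀ i, IsOpen (I i) ∧ (I i).OrdConnected) →
    Set.univ.pi I ⊆ Q → Set.InjOn X (Set.univ.pi I) →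
    ∀ q₀ ∈ Set.univ.pi I, ∀ u v : Fin 3 → ℂ,
      ∃ (E : ℂ) (f : Fin 3 → ℝ → ℂ) (φ : E3 → ℂ),
        (∀ i, ContDiffOn ℝ ∞ (f i) (I i) ∧ f i (q₀ i) = 1 ∧
          deriv (f i) (q₀ i) = u i ∧ deriv (deriv (f i)) (q₀ i) = v i) ∧
        (∀ q ∈ Set.univ.pi I, φ (X q) = ∏ i, f i (q i)) ∧
        ContDiffOn ℝ ∞ φ (X '' Set.univ.pi I) ∧
        ∀ x ∈ X '' Set.univ.pi I, T φ x = E * φ x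

/-!
# Superintegrability and multiseparability of `½ Δ + F(ψ) / r²`

The five functions `H_k` are written as `½ K_k^{ij} p_i p_j + V_k` in Cartesian coordinates, where
the entries of `K_k` are polynomials of degree at most two. The potential `V = F(ψ) / r²` satisfies
`x V_x + y V_y = -2 V` and `V_z = 0` away from the axis (`euler_pot_zero`, `pd_two_pot_zero`), and
these two identities give `dV_k = K_k dV` (`pd_pot`). With the Killing equation this yields
`{H, H_k} = 0` (`poisson_firstIntegral`).

The smooth functions on `Ω` form a commutative algebra on which the partial derivatives act as
commuting derivations. In it the commutator of `Ĥ` and `Ĥ_k`, expanded by the Leibniz rule, is a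
polynomial in the jets of the wave function, of the coordinates and of the potential, and it
vanishes by the same two identities (`derivationOp_comm`, `commuteOn_qop`). Order two and linear
independence are read off by applying the operators to quadratic polynomials centred at a point
(`isSecondOrderOn_qop`, `linIndepOn_qop`).

In rotational coordinates `(s, t, ψ)` with radial distance `ρ(s, t)` and height `ζ(s, t)`, the
Laplacian is a combination of `∂_s²`, `∂_s`, `∂_t²`, `∂_t` and `ρ⁻² ∂_ψ²`. For each of the five
types the coefficients have Stäckel form, which is what `SeparableProfile` records, so that the
eigenvalue equation splits into three second order linear ordinary differential equations with
three separation constants. Those constants are determined by the prescribed second derivatives,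
and the equations have smooth solutions with prescribed initial data
(`exists_contDiffOn_second_order`). The product of the solutions is carried to space by the smooth
inverse of the coordinate map on the box (`SeparableProfile.multiplicativelySeparable`).

The webs are told apart by four properties of a surface which similarities preserve: to be bounded,
to lie on a sphere, to be bounded with its diameter attained, and to contain some but not all
midpoints of its pairs of distinct points (`RotWeb.not_webEquiv`).
-/


open Filter Topology

/-! ### The region off the axis and the angular function -/

@[simp] lemma cyl_apply_zero (r ψ z : ℝ) : cyl r ψ z 0 = r * Real.cos ψ := rfl
@[simp] lemma cyl_apply_one (r ψ z : ℝ) : cyl r ψ z 1 = r * Real.sin ψ := rfl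
@[simp] lemma cyl_apply_two (r ψ z : ℝ) : cyl r ψ z 2 = z := rfl

lemma rad_sq (x : E3) : rad x ^ 2 = x 0 ^ 2 + x 1 ^ 2 := Real.sq_sqrt (by positivity)

lemma rad_cyl {r : ℝ} (hr : 0 ≤ r) (ψ z : ℝ) : rad (cyl r ψ z) = r := by
  have : (r * Real.cos ψ) ^ 2 + (r * Real.sin ψ) ^ 2 = r ^ 2 := by
    linear_combination r ^ 2 * Real.cos_sq_add_sin_sq ψ
  simp [rad, this, Real.sqrt_sq hr]

/-- The angle function recovers the angle of a point up to a multiple of `2π`, which a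
`2π`-periodic function does not see. -/
lemma Function.Periodic.apply_ang_cyl {F : ℝ → ℝ} (hper : Function.Periodic F (2 * Real.pi))
    {r : ℝ} (hr : 0 < r) (ψ z : ℝ) : F (ang (cyl r ψ z)) = F ψ := by
  have h : ((ang (cyl r ψ z) : ℝ) : Real.Angle) = ψ := by
    have := Complex.arg_mul_cos_add_sin_mul_I_coe_angle hr (ψ : Real.Angle)
    rw [← this, ang]
    congr 2
    apply Complex.ext
    · simp [-Complex.ofReal_cos]
    · simp [-Complex.ofReal_sin]
  obtain ⟨n, hn⟩ := Real.Angle.angle_eq_iff_two_pi_dvd_sub.1 h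
  rw [show ang (cyl r ψ z) = ψ + n * (2 * Real.pi) by linear_combination hn]
  exact hper.int_mul n ψ

lemma rad_pos_of_mem {D : Set ℝ} {x : E3} (hx : x ∈ region D) : 0 < rad x := by
  obtain ⟨r, ψ, z, hr, -, rfl⟩ := hx
  rwa [rad_cyl hr.le]

/-- Near a point of the region, the angle can be chosen as a smooth function with values in `D`,
although the normalised angle `ang` jumps across a half-plane. -/
lemma exists_local_angle {D : Set ℝ} (hD : IsOpen D) {x : E3} (hx : x ∈ region D) :
    ∃ θ : E3 → ℝ, ContDiffAt ℝ ∞ θ x ∧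
      ∀ᶠ y in 𝓝 x, 0 < rad y ∧ θ y ∈ D ∧ y = cyl (rad y) (θ y) (y 2) := by
  obtain ⟨r, ψ, z, hr, hψ, rfl⟩ := hx
  set x : E3 := cyl r ψ z with hx
  let c : E3 → ℂ := fun y => ((y 0 : ℂ) + (y 1 : ℂ) * Complex.I) * Complex.exp (-(ψ * Complex.I))
  have hc : ContDiff ℝ ∞ c := by
    have h0 : ContDiff ℝ ∞ fun y : E3 => ((y 0 : ℝ) : ℂ) :=
      Complex.ofRealCLM.contDiff.comp (by fun_prop)
    have h1 : ContDiff ℝ ∞ fun y : E3 => ((y 1 : ℝ) : ℂ) :=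
      Complex.ofRealCLM.contDiff.comp (by fun_prop)
    exact (h0.add (h1.mul contDiff_const)).mul contDiff_const
  have hcx : c x = r := by
    have : ((x 0 : ℝ) : ℂ) + ((x 1 : ℝ) : ℂ) * Complex.I = r * Complex.exp (ψ * Complex.I) := by
      rw [Complex.exp_mul_I]; simp [hx]; ring
    simp only [c, this, mul_assoc, ← Complex.exp_add]
    simp
  have hslit : c x ∈ Complex.slitPlane := by
    rw [hcx]; exact Complex.ofReal_mem_slitPlane.2 hr
  have hθ : ContDiffAt ℝ ∞ (fun y => ψ + (Complex.log (c y)).im) x := by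
    refine contDiffAt_const.add ?_
    have h1 : ContDiffAt ℝ ∞ Complex.log (c x) := (Complex.contDiffAt_log hslit).restrict_scalars ℝ
    exact (Complex.imCLM.contDiff.contDiffAt).comp x (h1.comp x hc.contDiffAt)
  refine ⟨_, hθ, ?_⟩
  have hθx : ψ + (Complex.log (c x)).im = ψ := by
    rw [hcx, Complex.log_im, Complex.arg_ofReal_of_nonneg hr.le, add_zero]
  have h1 : ∀ᶠ y in 𝓝 x, ψ + (Complex.log (c y)).im ∈ D :=
    hθ.continuousAt.eventually_mem (hD.mem_nhds (by simpa only [hθx] using hψ))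
  have h2 : ∀ᶠ y in 𝓝 x, c y ≠ 0 := hc.continuous.continuousAt.eventually_ne (by
    rw [hcx]; exact_mod_cast hr.ne')
  filter_upwards [h1, h2] with y hy1 hy2
  have hnorm : ‖c y‖ = rad y := by
    have e : ‖Complex.exp (-(ψ * Complex.I))‖ = 1 := by
      rw [Complex.norm_exp]; simp
    simp only [c, norm_mul, e, mul_one, Complex.norm_add_mul_I, rad]
  have hpos : 0 < rad y := hnorm ▸ norm_pos_iff.2 hy2
  refine ⟨hpos, hy1, ?_⟩
  have key : ((y 0 : ℝ) : ℂ) + ((y 1 : ℝ) : ℂ) * Complex.I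
      = rad y * Complex.exp ((ψ + (Complex.log (c y)).im : ℝ) * Complex.I) := by
    have h3 : (rad y : ℂ) * Complex.exp ((Complex.log (c y)).im * Complex.I) = c y := by
      rw [← hnorm, Complex.log_im, Complex.norm_mul_exp_arg_mul_I]
    have h4 : Complex.exp ((ψ + (Complex.log (c y)).im : ℝ) * Complex.I)
        = Complex.exp (ψ * Complex.I) * Complex.exp ((Complex.log (c y)).im * Complex.I) := by
      rw [← Complex.exp_add]; push_cast; ring_nf
    rw [h4, mul_left_comm, h3]
    simp only [c]
    rw [mul_left_comm, ← Complex.exp_add]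
    simp
  have hre := congrArg Complex.re key
  have him := congrArg Complex.im key
  rw [Complex.re_ofReal_mul, Complex.exp_ofReal_mul_I_re] at hre
  rw [Complex.im_ofReal_mul, Complex.exp_ofReal_mul_I_im] at him
  simp at hre him
  ext i
  fin_cases i
  · simpa using hre
  · simpa using him
  · simp

lemma isOpen_region {D : Set ℝ} (hD : IsOpen D) : IsOpen (region D) := by
  refine isOpen_iff_mem_nhds.2 fun x hx => ?_
  obtain ⟨θ, -, h⟩ := exists_local_angle hD hx
  filter_upwards [h] with y hy
  exact ⟨_, _, _, hy.1, hy.2.1, hy.2.2⟩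

lemma contDiffOn_comp_ang {F : ℝ → ℝ} {D : Set ℝ} (hper : Function.Periodic F (2 * Real.pi))
    (hD : IsOpen D) (hF : ContDiffOn ℝ ∞ F D) :
    ContDiffOn ℝ ∞ (fun x => F (ang x)) (region D) := by
  intro x hx
  obtain ⟨θ, hθ, h⟩ := exists_local_angle hD hx
  have h1 : ContDiffAt ℝ ∞ (fun y => F (θ y)) x :=
    (hF.contDiffAt (hD.mem_nhds h.self_of_nhds.2.1)).comp x hθ
  refine (h1.congr_of_eventuallyEq ?_).contDiffWithinAt
  filter_upwards [h] with y hy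
  conv_lhs => rw [hy.2.2]
  exact hper.apply_ang_cyl hy.1 _ _

/-! ### Partial derivatives -/

section pd
variable {G : Type*} [NormedAddCommGroup G] [NormedSpace ℝ G]

lemma fderiv_eq_sum_pd {f : E3 → G} (x v : E3) : fderiv ℝ f x v = ∑ i, v i • pd i f x := by
  have hv : v = ∑ i, v i • EuclideanSpace.single i (1 : ℝ) := by
    ext j
    simp [Finset.sum_apply, Pi.single_apply]
  conv_lhs => rw [hv]
  simp [pd, map_sum]

lemma pd_congr {Ω : Set E3} (hΩ : IsOpen Ω) {f g : E3 → G} (h : ∀ x ∈ Ω, f x = g x) (i : Fin 3)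
    {x : E3} (hx : x ∈ Ω) : pd i f x = pd i g x := by
  have : f =ᶠ[𝓝 x] g := by filter_upwards [hΩ.mem_nhds hx] with y hy using h y hy
  rw [pd, pd, this.fderiv_eq]

lemma ContDiffOn.pd {Ω : Set E3} (hΩ : IsOpen Ω) {f : E3 → G} (hf : ContDiffOn ℝ ∞ f Ω)
    (i : Fin 3) : ContDiffOn ℝ ∞ (_root_.pd i f) Ω :=
  (hf.fderiv_of_isOpen hΩ (m := ∞) le_rfl).clm_apply contDiffOn_const

lemma ContDiffOn.differentiableAt_of_isOpen {Ω : Set E3} (hΩ : IsOpen Ω) {f : E3 → G}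
    (hf : ContDiffOn ℝ ∞ f Ω) {x : E3} (hx : x ∈ Ω) : DifferentiableAt ℝ f x :=
  (hf.contDiffAt (hΩ.mem_nhds hx)).differentiableAt (by simp)

lemma pd_add {f g : E3 → G} {x : E3} (hf : DifferentiableAt ℝ f x) (hg : DifferentiableAt ℝ g x)
    (i : Fin 3) : pd i (fun y => f y + g y) x = pd i f x + pd i g x := by
  simp [pd, fderiv_fun_add hf hg]

lemma pd_mul {A : Type*} [NormedCommRing A] [NormedAlgebra ℝ A] {f g : E3 → A} {x : E3}
    (hf : DifferentiableAt ℝ f x) (hg : DifferentiableAt ℝ g x)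
    (i : Fin 3) : pd i (fun y => f y * g y) x = f x * pd i g x + g x * pd i f x := by
  simp [pd, fderiv_fun_mul hf hg]

lemma pd_const (i : Fin 3) (c : G) (x : E3) : pd i (fun _ => c) x = 0 := by simp [pd]

lemma pd_coord (i j : Fin 3) (x : E3) : pd i (fun y => y j) x = if i = j then 1 else 0 := by
  have : HasFDerivAt (fun y : E3 => y j) (EuclideanSpace.proj j : E3 →L[ℝ] ℝ) x :=
    (EuclideanSpace.proj j : E3 →L[ℝ] ℝ).hasFDerivAt
  rw [pd, this.fderiv]
  simp [PiLp.single_apply, eq_comm]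

lemma pd_ofReal {f : E3 → ℝ} {x : E3} (hf : DifferentiableAt ℝ f x) (i : Fin 3) :
    pd i (fun y => (f y : ℂ)) x = ((pd i f x : ℝ) : ℂ) := by
  have := (Complex.ofRealCLM.hasFDerivAt (x := f x)).comp x hf.hasFDerivAt
  rw [pd, show (fun y => (f y : ℂ)) = Complex.ofRealCLM ∘ f from rfl, this.fderiv]
  simp [pd]

lemma pd_comm {Ω : Set E3} (hΩ : IsOpen Ω) {f : E3 → G} (hf : ContDiffOn ℝ ∞ f Ω) (i j : Fin 3)
    {x : E3} (hx : x ∈ Ω) : pd i (pd j f) x = pd j (pd i f) x := by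
  have hfx := hf.contDiffAt (hΩ.mem_nhds hx)
  have hs : IsSymmSndFDerivAt ℝ f x := hfx.isSymmSndFDerivAt (by simp; norm_cast)
  have hd : DifferentiableAt ℝ (fderiv ℝ f) x :=
    (hfx.fderiv_right (m := 1) (by norm_cast)).differentiableAt (by simp)
  have key : ∀ i j : Fin 3, pd i (pd j f) x
      = fderiv ℝ (fderiv ℝ f) x (EuclideanSpace.single i 1) (EuclideanSpace.single j 1) := by
    intro i j
    have := (hd.hasFDerivAt.clm_apply (hasFDerivAt_const (EuclideanSpace.single j (1 : ℝ)) x)).fderiv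
    rw [pd, show pd j f = fun y => fderiv ℝ f y (EuclideanSpace.single j 1) from rfl, this]
    simp
  rw [key, key]
  exact hs _ _

end pd

/-! ### The potential -/

lemma ang_add_single_two (x : E3) (t : ℝ) :
    ang (x + t • EuclideanSpace.single 2 1) = ang x ∧
      rad (x + t • EuclideanSpace.single 2 1) = rad x := by
  simp [ang, rad]

lemma ang_rad_dilate (x : E3) {t : ℝ} (ht : 0 < 1 + t) :
    ang (x + t • !₂[x 0, x 1, 0]) = ang x ∧
      rad (x + t • !₂[x 0, x 1, 0]) = (1 + t) * rad x := by
  constructor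
  · rw [ang, ang, ← Complex.arg_real_mul (⟨x 0, x 1⟩ : ℂ) ht]
    congr 1
    apply Complex.ext <;> simp <;> ring
  · have h : (1 + t) * rad x = √((1 + t) ^ 2 * (x 0 ^ 2 + x 1 ^ 2)) := by
      rw [Real.sqrt_mul (by positivity), Real.sqrt_sq ht.le, rad]
    rw [h, rad]
    congr 1
    simp
    ring

lemma contDiffOn_pot {F : ℝ → ℝ} {D : Set ℝ} (hper : Function.Periodic F (2 * Real.pi))
    (hD : IsOpen D) (hF : ContDiffOn ℝ ∞ F D) (k : Fin 5) :
    ContDiffOn ℝ ∞ (pot F k) (region D) := by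
  have hG := contDiffOn_comp_ang hper hD hF
  have hr : ContDiffOn ℝ ∞ (fun x => rad x ^ 2) (region D) := by
    have : (fun x => rad x ^ 2) = fun x : E3 => x 0 ^ 2 + x 1 ^ 2 := funext rad_sq
    rw [this]; fun_prop
  have hr0 : ∀ x ∈ region D, rad x ^ 2 ≠ 0 := fun x hx => pow_ne_zero _ (rad_pos_of_mem hx).ne'
  have hz : ContDiffOn ℝ ∞ (fun x : E3 => x 2) (region D) := by fun_prop
  fin_cases k
  · exact hG.div hr hr0
  · exact hG
  · exact contDiffOn_const
  · exact (contDiffOn_const.add ((hz.pow 2).div hr hr0)).mul hG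
  · exact (hz.div hr hr0).mul hG

/-- The potential does not depend on the height. -/
lemma pd_two_pot_zero (F : ℝ → ℝ) {x : E3} (h : DifferentiableAt ℝ (pot F 0) x) :
    pd 2 (pot F 0) x = 0 := by
  have h1 := h.hasFDerivAt.hasLineDerivAt (EuclideanSpace.single 2 (1 : ℝ))
  have h2 : HasLineDerivAt ℝ (pot F 0) 0 x (EuclideanSpace.single 2 (1 : ℝ)) := by
    have : (fun t : ℝ => pot F 0 (x + t • EuclideanSpace.single 2 (1 : ℝ)))
        = fun _ => pot F 0 x := by
      funext t
      simp only [pot, Matrix.cons_val_zero, ang_add_single_two]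
    rw [HasLineDerivAt, this]
    exact hasDerivAt_const _ _
  exact h1.unique h2

/-- The potential is homogeneous of degree `-2` under dilations of the planes orthogonal to the
axis (Euler's relation). -/
lemma euler_pot_zero (F : ℝ → ℝ) {x : E3} (h : DifferentiableAt ℝ (pot F 0) x) :
    x 0 * pd 0 (pot F 0) x + x 1 * pd 1 (pot F 0) x = -2 * pot F 0 x := by
  have h1 := h.hasFDerivAt.hasLineDerivAt (!₂[x 0, x 1, 0] : E3)
  have h2 : HasLineDerivAt ℝ (pot F 0) (-2 * pot F 0 x) x (!₂[x 0, x 1, 0] : E3) := by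
    have hd : HasDerivAt (fun t : ℝ => ((1 + t) ^ 2)⁻¹ * pot F 0 x) (-2 * pot F 0 x) 0 := by
      have := ((((hasDerivAt_id (0 : ℝ)).const_add 1).fun_pow 2).fun_inv (by simp)).mul_const
        (pot F 0 x)
      exact this.congr_deriv (by norm_num)
    refine hd.congr_of_eventuallyEq ?_
    have : ∀ᶠ t : ℝ in 𝓝 0, 0 < 1 + t :=
      (continuous_const.add continuous_id).continuousAt.eventually_const_lt (by simp)
    filter_upwards [this] with t ht
    simp only [pot, Matrix.cons_val_zero, ang_rad_dilate x ht]
    by_cases hr : rad x = 0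
    · simp [hr]
    · field_simp
  have := h1.unique h2
  rw [fderiv_eq_sum_pd] at this
  simpa [Fin.sum_univ_three] using this

lemma pot_one_eq (F : ℝ → ℝ) {x : E3} (hx : 0 < rad x) :
    pot F 1 x = (x 0 ^ 2 + x 1 ^ 2) * pot F 0 x := by
  have := hx.ne'
  simp only [pot, Matrix.cons_val_zero, Matrix.cons_val_one, ← rad_sq]
  field_simp

lemma pot_three_eq (F : ℝ → ℝ) {x : E3} (hx : 0 < rad x) :
    pot F 3 x = (x 0 ^ 2 + x 1 ^ 2 + x 2 ^ 2) * pot F 0 x := by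
  have := hx.ne'
  simp only [pot, ← rad_sq, Matrix.cons_val]
  field_simp

lemma pot_four_eq (F : ℝ → ℝ) (x : E3) : pot F 4 x = x 2 * pot F 0 x := by
  simp only [pot, Matrix.cons_val]
  ring

/-! ### Killing tensors and Poisson brackets -/

lemma killing_zero (x : E3) : killing 0 x = !![1, 0, 0; 0, 1, 0; 0, 0, 1] := by
  ext i j; fin_cases i <;> fin_cases j <;> rfl
lemma killing_one (x : E3) : killing 1 x
    = !![x 1 ^ 2, -(x 0 * x 1), 0; -(x 0 * x 1), x 0 ^ 2, 0; 0, 0, 0] := rfl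
lemma killing_two (x : E3) : killing 2 x = !![0, 0, 0; 0, 0, 0; 0, 0, 1] := rfl
lemma killing_three (x : E3) : killing 3 x
    = !![x 1 ^ 2 + x 2 ^ 2, -(x 0 * x 1), -(x 0 * x 2);
         -(x 0 * x 1), x 0 ^ 2 + x 2 ^ 2, -(x 1 * x 2);
         -(x 0 * x 2), -(x 1 * x 2), x 0 ^ 2 + x 1 ^ 2] := rfl
lemma killing_four (x : E3) : killing 4 x
    = !![x 2, 0, -(x 0 / 2); 0, x 2, -(x 1 / 2); -(x 0 / 2), -(x 1 / 2), 0] := rfl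

lemma contDiff_killing (k : Fin 5) (i j : Fin 3) : ContDiff ℝ ∞ fun x => killing k x i j := by
  match k with
  | 0 => simp only [killing_zero]; exact contDiff_const
  | 1 => simp only [killing_one]; fin_cases i <;> fin_cases j <;> simp <;> fun_prop
  | 2 => simp only [killing_two]; exact contDiff_const
  | 3 => simp only [killing_three]; fin_cases i <;> fin_cases j <;> simp <;> fun_prop
  | 4 => simp only [killing_four]; fin_cases i <;> fin_cases j <;> simp <;> fun_prop

lemma isSymm_killing (k : Fin 5) (x : E3) : (killing k x).IsSymm := by
  ext i j
  match k with
  | 0 => rw [killing_zero]; fin_cases i <;> fin_cases j <;> rfl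
  | 1 => rw [killing_one]; fin_cases i <;> fin_cases j <;> rfl
  | 2 => rw [killing_two]; fin_cases i <;> fin_cases j <;> rfl
  | 3 => rw [killing_three]; fin_cases i <;> fin_cases j <;> rfl
  | 4 => rw [killing_four]; fin_cases i <;> fin_cases j <;> rfl

lemma pd_neg (f : E3 → ℝ) (i : Fin 3) (x : E3) : pd i (fun y => -f y) x = -pd i f x := by
  simp [pd, fderiv_fun_neg]

lemma pd_coord_sq (i m : Fin 3) (x : E3) :
    pd i (fun y => y m ^ 2) x = 2 * x m * if i = m then 1 else 0 := by
  have := pd_mul (f := fun y : E3 => y m) (g := fun y : E3 => y m) (x := x)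
    (by fun_prop) (by fun_prop) i
  simp only [sq, this, pd_coord]; ring

lemma pd_coord_div_two (i m : Fin 3) (x : E3) :
    pd i (fun y => y m / 2) x = (if i = m then 1 else 0) / 2 := by
  have := pd_mul (f := fun y : E3 => y m) (g := fun _ : E3 => (2⁻¹ : ℝ)) (x := x)
    (by fun_prop) (by fun_prop) i
  simp only [div_eq_mul_inv, this, pd_const, pd_coord]; ring

/-- The derivative of the Killing tensor `killing k` at `x` in the direction `v`. -/
noncomputable def killingDeriv : Fin 5 → (Fin 3 → ℝ) → E3 → Matrix (Fin 3) (Fin 3) ℝ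
  | 0, _, _ => 0
  | 1, v, x => !![2 * x 1 * v 1, -(x 0 * v 1 + x 1 * v 0), 0;
                  -(x 0 * v 1 + x 1 * v 0), 2 * x 0 * v 0, 0; 0, 0, 0]
  | 2, _, _ => 0
  | 3, v, x => !![2 * x 1 * v 1 + 2 * x 2 * v 2, -(x 0 * v 1 + x 1 * v 0),
                    -(x 0 * v 2 + x 2 * v 0);
                  -(x 0 * v 1 + x 1 * v 0), 2 * x 0 * v 0 + 2 * x 2 * v 2,
                    -(x 1 * v 2 + x 2 * v 1);
                  -(x 0 * v 2 + x 2 * v 0), -(x 1 * v 2 + x 2 * v 1),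
                    2 * x 0 * v 0 + 2 * x 1 * v 1]
  | 4, v, _ => !![v 2, 0, -(v 0 / 2); 0, v 2, -(v 1 / 2); -(v 0 / 2), -(v 1 / 2), 0]

lemma pd_killing (k : Fin 5) (i j l : Fin 3) (x : E3) :
    pd i (fun y => killing k y j l) x
      = killingDeriv k (fun m => if i = m then 1 else 0) x j l := by
  match k with
  | 0 => simp only [killing_zero]; exact pd_const _ _ _
  | 1 =>
    simp only [killing_one, killingDeriv]
    fin_cases j <;> fin_cases l <;>
      simp (disch := fun_prop) [pd_mul, pd_const, pd_coord, pd_neg, pd_coord_sq]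
  | 2 => simp only [killing_two]; exact pd_const _ _ _
  | 3 =>
    simp only [killing_three, killingDeriv]
    fin_cases j <;> fin_cases l <;>
      simp (disch := fun_prop) [pd_mul, pd_add, pd_coord, pd_neg, pd_coord_sq]
  | 4 =>
    simp only [killing_four, killingDeriv]
    fin_cases j <;> fin_cases l <;>
      simp [pd_const, pd_coord, pd_neg, pd_coord_div_two]

lemma isKillingTensor_killing (k : Fin 5) : IsKillingTensor (killing k) := by
  refine ⟨contDiff_killing k, isSymm_killing k, fun x i j l => ?_⟩
  simp only [pd_killing]
  match k with
  | 0 => simp [killingDeriv]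
  | 1 =>
    simp only [killingDeriv]
    fin_cases i <;> fin_cases j <;> fin_cases l <;> simp <;> ring
  | 2 => simp [killingDeriv]
  | 3 =>
    simp only [killingDeriv]
    fin_cases i <;> fin_cases j <;> fin_cases l <;> simp <;> ring
  | 4 =>
    simp only [killingDeriv]
    fin_cases i <;> fin_cases j <;> fin_cases l <;> simp <;> norm_num

lemma firstIntegral_eq (F : ℝ → ℝ) (k : Fin 5) {x : E3} (hx : 0 < rad x) (p : E3) :
    firstIntegral F k x p
      = 1 / 2 * ∑ i : Fin 3, ∑ j : Fin 3, killing k x i j * p i * p j + pot F k x := by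
  have h0 := hx.ne'
  have h1 := rad_sq x
  -- `p_r² + p_ψ² / r²` is the squared length of the momentum orthogonal to the axis
  have h2 : momR x p ^ 2 + momPsi x p ^ 2 / rad x ^ 2 = p 0 ^ 2 + p 1 ^ 2 := by
    rw [momR, momPsi]
    field_simp
    rw [h1]; ring
  have h3 : rad x * momR x p = x 0 * p 0 + x 1 * p 1 := by
    rw [momR]; field_simp
  match k with
  | 0 =>
    rw [killing_zero, show firstIntegral F 0 x p = 1 / 2 * (momR x p ^ 2
      + 1 / rad x ^ 2 * momPsi x p ^ 2 + p 2 ^ 2) + pot F 0 x from rfl]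
    simp only [Fin.sum_univ_three, Matrix.of_apply, Matrix.cons_val]
    linear_combination h2 / 2
  | 1 =>
    rw [killing_one, show firstIntegral F 1 x p = 1 / 2 * momPsi x p ^ 2 + pot F 1 x from rfl]
    simp only [Fin.sum_univ_three, Matrix.of_apply, Matrix.cons_val, momPsi]
    ring
  | 2 =>
    rw [killing_two, show firstIntegral F 2 x p = 1 / 2 * p 2 ^ 2 from rfl,
      show pot F 2 x = 0 from rfl]
    simp only [Fin.sum_univ_three, Matrix.of_apply, Matrix.cons_val]
    ring
  | 3 =>
    rw [killing_three, show firstIntegral F 3 x p = 1 / 2 * ((rad x * p 2 - x 2 * momR x p) ^ 2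
        + (1 + x 2 ^ 2 / rad x ^ 2) * momPsi x p ^ 2) + pot F 3 x from rfl]
    simp only [Fin.sum_univ_three, Matrix.of_apply, Matrix.cons_val]
    have h4 : momPsi x p = x 0 * p 1 - x 1 * p 0 := rfl
    linear_combination x 2 ^ 2 / 2 * h2 + p 2 ^ 2 / 2 * h1 - x 2 * p 2 * h3
      + (momPsi x p + x 0 * p 1 - x 1 * p 0) / 2 * h4
  | 4 =>
    rw [killing_four, show firstIntegral F 4 x p = 1 / 2 * (x 2 * momR x p ^ 2
        + x 2 / rad x ^ 2 * momPsi x p ^ 2 - rad x * momR x p * p 2) + pot F 4 x from rfl]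
    simp only [Fin.sum_univ_three, Matrix.of_apply, Matrix.cons_val]
    linear_combination x 2 / 2 * h2 - p 2 / 2 * h3

/-- The compatibility condition `dV_k = K_k dV` between the Killing tensors and the potentials,
which makes `½ K_k^{ij} p_i p_j + V_k` a first integral. -/
lemma pd_pot (F : ℝ → ℝ) (k : Fin 5) {Ω : Set E3} (hΩ : IsOpen Ω) (hr : ∀ x ∈ Ω, 0 < rad x)
    (hV : ContDiffOn ℝ ∞ (pot F 0) Ω) (i : Fin 3) {x : E3} (hx : x ∈ Ω) :
    pd i (pot F k) x = ∑ j, killing k x i j * pd j (pot F 0) x := by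
  have hd := hV.differentiableAt_of_isOpen hΩ hx
  have he := euler_pot_zero F hd
  have hz := pd_two_pot_zero F hd
  match k with
  | 0 => rw [killing_zero]; fin_cases i <;> simp [Fin.sum_univ_three]
  | 1 =>
    rw [killing_one, pd_congr hΩ (fun y hy => pot_one_eq F (hr y hy)) i hx]
    fin_cases i <;> simp (disch := fun_prop (disch := assumption))
      [Fin.sum_univ_three, pd_mul, pd_add, pd_coord_sq, hz]
    · linear_combination x 0 * he
    · linear_combination x 1 * he
  | 2 => rw [killing_two]; fin_cases i <;> simp [Fin.sum_univ_three, hz] <;> exact pd_const _ _ _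
  | 3 =>
    rw [killing_three, pd_congr hΩ (fun y hy => pot_three_eq F (hr y hy)) i hx]
    fin_cases i <;> simp (disch := fun_prop (disch := assumption))
      [Fin.sum_univ_three, pd_mul, pd_add, pd_coord_sq, hz]
    · linear_combination x 0 * he
    · linear_combination x 1 * he
    · linear_combination x 2 * he
  | 4 =>
    rw [killing_four, pd_congr hΩ (fun y hy => pot_four_eq F y) i hx]
    fin_cases i <;> simp (disch := fun_prop (disch := assumption))
      [Fin.sum_univ_three, pd_mul, pd_coord, hz]
    linear_combination he / 2

/-- The brackets vanish: their part cubic in the momenta by the Killing equation, and the linear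
part by `dV_k = K_k dV`. -/
lemma poisson_firstIntegral (F : ℝ → ℝ) (k : Fin 5) {Ω : Set E3} (hΩ : IsOpen Ω)
    (hr : ∀ x ∈ Ω, 0 < rad x) (hV : ContDiffOn ℝ ∞ (pot F 0) Ω)
    (hVk : ContDiffOn ℝ ∞ (pot F k) Ω) {x : E3} (hx : x ∈ Ω) (p : E3) :
    poisson (firstIntegral F 0) (firstIntegral F k) x p = 0 := by
  have hpos : ∀ (k : Fin 5), ContDiffOn ℝ ∞ (pot F k) Ω → ∀ i : Fin 3,
      pd i (fun y => firstIntegral F k y p) x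
        = 1 / 2 * ∑ j : Fin 3, ∑ l : Fin 3,
            killingDeriv k (fun m => if i = m then 1 else 0) x j l * p j * p l
          + pd i (pot F k) x := by
    intro k hVk i
    rw [pd_congr hΩ (fun y hy => firstIntegral_eq F k (hr y hy) p) i hx]
    have hK : ∀ j l, DifferentiableAt ℝ (fun y => killing k y j l) x := fun j l =>
      (contDiff_killing k j l).differentiable (by simp) x
    have hd := hVk.differentiableAt_of_isOpen hΩ hx
    simp (disch := fun_prop) only [Fin.sum_univ_three, pd_mul, pd_add, pd_const, pd_killing]
    ring
  have hmom : ∀ (k : Fin 5) (i : Fin 3),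
      pd i (firstIntegral F k x) p = ∑ j, killing k x i j * p j := by
    intro k i
    rw [show firstIntegral F k x = _ from funext fun p => firstIntegral_eq F k (hr x hx) p]
    have hs : ∀ i j, killing k x j i = killing k x i j := fun i j => (isSymm_killing k x).apply i j
    simp (disch := fun_prop) only [Fin.sum_univ_three, pd_mul, pd_add, pd_const, pd_coord]
    fin_cases i <;> simp [hs 0 1, hs 0 2, hs 1 2] <;> ring
  have hK := (isKillingTensor_killing k).2.2 x
  simp only [pd_killing] at hK
  have hcubic : ∑ i : Fin 3, ∑ j : Fin 3, ∑ l : Fin 3, p i * p j * p l *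
      (killingDeriv k (fun m => if i = m then 1 else 0) x j l
        + killingDeriv k (fun m => if j = m then 1 else 0) x l i
        + killingDeriv k (fun m => if l = m then 1 else 0) x i j) = 0 := by
    simp only [hK, mul_zero, Finset.sum_const_zero]
  have hs : ∀ i j, killing k x j i = killing k x i j := fun i j => (isSymm_killing k x).apply i j
  simp only [poisson, hpos 0 hV, hpos k hVk, hmom, pd_pot F k hΩ hr hV _ hx]
  rw [killing_zero]
  have hd : ∀ v, killingDeriv 0 v x = 0 := fun _ => rfl
  simp only [hd, Fin.sum_univ_three, hs 0 1, hs 0 2, hs 1 2, Matrix.zero_apply] at hcubic ⊢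
  simp only [Matrix.of_apply, Matrix.cons_val]
  linear_combination -(1 / 6) * hcubic

/-! ### Order and linear independence -/

lemma quantize_eq {K : E3 → Matrix (Fin 3) (Fin 3) ℝ} (hK : ∀ i j, ContDiff ℝ ∞ fun x => K x i j)
    (W : E3 → ℝ) {Ω : Set E3} (hΩ : IsOpen Ω) {φ : E3 → ℂ} (hφ : ContDiffOn ℝ ∞ φ Ω) {x : E3}
    (hx : x ∈ Ω) :
    quantize K W φ x = 1 / 2 * ∑ i : Fin 3, ∑ j : Fin 3,
      ((K x i j : ℂ) * pd i (pd j φ) x + pd j φ x * ((pd i (fun y => K y i j) x : ℝ) : ℂ))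
      + (W x : ℂ) * φ x := by
  rw [quantize]
  congr 2
  refine Finset.sum_congr rfl fun i _ => Finset.sum_congr rfl fun j _ => ?_
  have hd : DifferentiableAt ℝ (fun y => K y i j) x := (hK i j).differentiable (by simp) x
  have hd' : DifferentiableAt ℝ (fun y => (K y i j : ℂ)) x :=
    Complex.ofRealCLM.differentiableAt.comp x hd
  rw [pd_mul hd' ((hφ.pd hΩ j).differentiableAt_of_isOpen hΩ hx), pd_ofReal hd]

/-- The wave function `x ↦ (v · (x - a))²`, whose value and gradient vanish at `a`. -/
noncomputable def quadProbe (v a : E3) (x : E3) : ℂ := ((inner ℝ v (x - a) ^ 2 : ℝ) : ℂ)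

lemma contDiff_quadProbe (v a : E3) : ContDiff ℝ ∞ (quadProbe v a) :=
  Complex.ofRealCLM.contDiff.comp ((contDiff_const.inner ℝ (contDiff_id.sub contDiff_const)).pow 2)

lemma pd_quadProbe (v a : E3) (i : Fin 3) (x : E3) :
    pd i (quadProbe v a) x = ((2 * v i * inner ℝ v (x - a) : ℝ) : ℂ) := by
  have h1 : HasFDerivAt (fun y : E3 => inner ℝ v (y - a)) (innerSL ℝ v) x :=
    (innerSL ℝ v).hasFDerivAt.comp x ((hasFDerivAt_id x).sub_const a)
  have h2 : pd i (fun y : E3 => inner ℝ v (y - a)) x = v i := by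
    rw [pd, h1.fderiv]; simp [EuclideanSpace.inner_single_right]
  have h3 := pd_mul h1.differentiableAt h1.differentiableAt i
  unfold quadProbe
  rw [pd_ofReal (h1.differentiableAt.fun_pow 2)]
  simp only [sq, h3, h2]
  congr 1; ring

lemma pd_pd_quadProbe (v a : E3) (i j : Fin 3) (x : E3) :
    pd i (pd j (quadProbe v a)) x = ((2 * v i * v j : ℝ) : ℂ) := by
  have h1 : HasFDerivAt (fun y : E3 => inner ℝ v (y - a)) (innerSL ℝ v) x :=
    (innerSL ℝ v).hasFDerivAt.comp x ((hasFDerivAt_id x).sub_const a)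
  have h2 : pd i (fun y : E3 => inner ℝ v (y - a)) x = v i := by
    rw [pd, h1.fderiv]; simp [EuclideanSpace.inner_single_right]
  rw [show pd j (quadProbe v a) = _ from funext (pd_quadProbe v a j),
    pd_ofReal ((differentiableAt_const _).fun_mul h1.differentiableAt),
    pd_mul (differentiableAt_const _) h1.differentiableAt, h2, pd_const]
  congr 1; ring

lemma quadProbe_self (v a : E3) : quadProbe v a a = 0 := by simp [quadProbe]

lemma pd_quadProbe_self (v a : E3) (i : Fin 3) : pd i (quadProbe v a) a = 0 := by
  simp [pd_quadProbe]

/-- Applied to a quadratic probe, the operator reads off its principal symbol. -/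
lemma qop_quadProbe (F : ℝ → ℝ) (k : Fin 5) (v a : E3) :
    qop F k (quadProbe v a) a = ((∑ i, ∑ j, killing k a i j * v i * v j : ℝ) : ℂ) := by
  rw [qop, quantize_eq (contDiff_killing k) _ isOpen_univ (contDiff_quadProbe v a).contDiffOn
    (Set.mem_univ a)]
  simp only [pd_pd_quadProbe, pd_quadProbe_self, quadProbe_self, zero_mul, mul_zero, add_zero]
  push_cast
  rw [Finset.mul_sum]
  refine Finset.sum_congr rfl fun i _ => ?_
  rw [Finset.mul_sum]
  refine Finset.sum_congr rfl fun j _ => ?_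
  ring

lemma exists_killing_ne_zero (k : Fin 5) {a : E3} (ha : 0 < rad a) :
    ∃ v : E3, ∑ i, ∑ j, killing k a i j * v i * v j ≠ 0 := by
  have h := rad_sq a
  have h' : 0 < rad a ^ 2 := by positivity
  match k with
  | 0 => exact ⟨!₂[0, 0, 1], by rw [killing_zero]; simp [Fin.sum_univ_three]⟩
  | 1 =>
    refine ⟨!₂[-a 1, a 0, 0], ?_⟩
    have : (a 0 ^ 2 + a 1 ^ 2) ^ 2 ≠ 0 := by rw [← h]; positivity
    rw [killing_one]
    simp only [Fin.sum_univ_three, Matrix.of_apply, Matrix.cons_val]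
    convert this using 1
    ring
  | 2 => exact ⟨!₂[0, 0, 1], by rw [killing_two]; simp [Fin.sum_univ_three]⟩
  | 3 =>
    refine ⟨!₂[0, 0, 1], ?_⟩
    have : a 0 ^ 2 + a 1 ^ 2 ≠ 0 := by rw [← h]; positivity
    rw [killing_three]
    simpa [Fin.sum_univ_three] using this
  | 4 =>
    rw [killing_four]
    by_contra! hc
    have h1 := hc !₂[a 0, a 1, 1]
    have h2 := hc !₂[a 0, a 1, -1]
    simp only [Fin.sum_univ_three, Matrix.of_apply, Matrix.cons_val] at h1 h2
    nlinarith

lemma isSecondOrderOn_qop (F : ℝ → ℝ) {D : Set ℝ} (hD : IsOpen D) (hne : D.Nonempty)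
    (k : Fin 5) : IsSecondOrderOn (region D) (qop F k) := by
  constructor
  · refine ⟨fun i j x => 1 / 2 * (killing k x i j : ℂ),
      fun j x => 1 / 2 * ∑ i, ((pd i (fun y => killing k y i j) x : ℝ) : ℂ),
      fun x => (pot F k x : ℂ), fun φ hφ x hx => ?_⟩
    rw [qop, quantize_eq (contDiff_killing k) _ (isOpen_region hD) hφ hx]
    simp only [Fin.sum_univ_three]
    ring
  · rintro ⟨b, c, h⟩
    obtain ⟨ψ, hψ⟩ := hne
    have ha : cyl 1 ψ 0 ∈ region D := ⟨1, ψ, 0, one_pos, hψ, rfl⟩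
    obtain ⟨v, hv⟩ := exists_killing_ne_zero k (rad_pos_of_mem ha)
    have := h (quadProbe v (cyl 1 ψ 0)) (contDiff_quadProbe _ _).contDiffOn _ ha
    rw [qop_quadProbe] at this
    simp only [pd_quadProbe_self, quadProbe_self, mul_zero, Finset.sum_const_zero, add_zero] at this
    exact hv (by exact_mod_cast this)

lemma linIndepOn_qop (F : ℝ → ℝ) {D : Set ℝ} (hne : D.Nonempty) :
    LinIndepOn (region D) (qop F) := by
  intro c hc
  obtain ⟨ψ, hψ⟩ := hne
  have key : ∀ (r z : ℝ), 0 < r → ∀ v : E3,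
      ∑ k, c k * ((∑ i, ∑ j, killing k (cyl r ψ z) i j * v i * v j : ℝ) : ℂ) = 0 := by
    intro r z hr v
    have := hc (quadProbe v (cyl r ψ z)) (contDiff_quadProbe _ _).contDiffOn _
      ⟨r, ψ, z, hr, hψ, rfl⟩
    simpa only [qop_quadProbe] using this
  -- the symbols in the vertical and in the angular direction
  have hvert : ∀ r : ℝ, 0 < r → c 0 + c 2 + c 3 * (r : ℂ) ^ 2 = 0 := by
    intro r hr
    have h := key r 0 hr !₂[0, 0, 1]
    rw [Fin.sum_univ_five, killing_zero, killing_one, killing_two, killing_three,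
      killing_four] at h
    simp [Fin.sum_univ_three] at h
    have e : (r : ℂ) ^ 2 * (Complex.cos ψ ^ 2 + Complex.sin ψ ^ 2) = (r : ℂ) ^ 2 := by
      rw [Complex.cos_sq_add_sin_sq, mul_one]
    linear_combination h - c 3 * e
  have hang : ∀ r z : ℝ, 0 < r →
      c 0 + c 1 * (r : ℂ) ^ 2 + c 3 * ((r : ℂ) ^ 2 + (z : ℂ) ^ 2) + c 4 * z = 0 := by
    intro r z hr
    have h := key r z hr !₂[-Real.sin ψ, Real.cos ψ, 0]
    rw [Fin.sum_univ_five, killing_zero, killing_one, killing_two, killing_three,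
      killing_four] at h
    simp [Fin.sum_univ_three] at h
    have e := Complex.sin_sq_add_cos_sq ψ
    have e2 : (Complex.sin ψ ^ 2 + Complex.cos ψ ^ 2) ^ 2 = 1 := by rw [e, one_pow]
    linear_combination h - (c 0 + c 3 * z ^ 2 + c 4 * z) * e - (c 1 + c 3) * r ^ 2 * e2
  have v1 := hvert 1 one_pos
  have v2 := hvert 2 two_pos
  have a1 := hang 1 0 one_pos
  have a2 := hang 2 0 two_pos
  have a3 := hang 1 1 one_pos
  push_cast at v1 v2 a1 a2 a3
  have h3 : c 3 = 0 := by linear_combination (v2 - v1) / 3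
  have h1 : c 1 = 0 := by linear_combination (a2 - a1) / 3 - h3
  have h0 : c 0 = 0 := by linear_combination a1 - h3 - h1
  have h2 : c 2 = 0 := by linear_combination v1 - h3 - h0
  have h4 : c 4 = 0 := by linear_combination a3 - h0 - h1 - 2 * h3
  funext k
  fin_cases k <;> assumption

/-! ### Commutation with the Schrödinger operator -/

section algebra
variable {A : Type*} [CommRing A] [Algebra ℂ A] (d : Fin 3 → Derivation ℂ A A)

/-- The operator `f ↦ h ∑ dᵢ (Kᵢⱼ dⱼ f) + W f` in a commutative algebra with three
derivations; `quantize` is the case of the smooth functions on a region, with `h = 1/2`. -/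
def derivationOp (h : A) (K : Matrix (Fin 3) (Fin 3) A) (W f : A) : A :=
  h * ∑ i, ∑ j, d i (K i j * d j f) + W * f

/-- The Killing tensors `killing k` with the coordinates replaced by elements `x i` of an algebra
and `1 / 2` by `h`. -/
def killingIn (x : Fin 3 → A) (h : A) : Fin 5 → Matrix (Fin 3) (Fin 3) A
  | 0 => !![1, 0, 0; 0, 1, 0; 0, 0, 1]
  | 1 => !![x 1 ^ 2, -(x 0 * x 1), 0; -(x 0 * x 1), x 0 ^ 2, 0; 0, 0, 0]
  | 2 => !![0, 0, 0; 0, 0, 0; 0, 0, 1]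
  | 3 => !![x 1 ^ 2 + x 2 ^ 2, -(x 0 * x 1), -(x 0 * x 2);
            -(x 0 * x 1), x 0 ^ 2 + x 2 ^ 2, -(x 1 * x 2);
            -(x 0 * x 2), -(x 1 * x 2), x 0 ^ 2 + x 1 ^ 2]
  | 4 => !![h * (x 2 + x 2), 0, -(h * x 0); 0, h * (x 2 + x 2), -(h * x 1); -(h * x 0), -(h * x 1), 0]

/-- The scalar parts belonging to `killingIn`, in terms of the potential `U`. -/
def potIn (x : Fin 3 → A) (h U : A) : Fin 5 → A
  | 0 => U
  | 1 => (x 0 ^ 2 + x 1 ^ 2) * U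
  | 2 => 0
  | 3 => (x 0 ^ 2 + x 1 ^ 2 + x 2 ^ 2) * U
  | 4 => h * (x 2 + x 2) * U

variable {d}

set_option linter.unusedSimpArgs false in
/-- The commutators vanish identically in the jets of `f`: the terms with derivatives of `f` of
order two and more cancel, and what remains is a combination of Euler's relation for the potential
`U` and its derivatives. -/
lemma derivationOp_comm (hcomm : ∀ i j f, d i (d j f) = d j (d i f)) {x : Fin 3 → A}
    (hx : ∀ i j, d i (x j) = if i = j then 1 else 0) {h U : A} (hh : ∀ i, d i h = 0)
    (hE : x 0 * d 0 U + x 1 * d 1 U = -2 * U) (hU : d 2 U = 0) (f : A) (k : Fin 5) (hk : k ≠ 0) :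
    derivationOp d h (killingIn x h 0) (potIn x h U 0)
        (derivationOp d h (killingIn x h k) (potIn x h U k) f)
      = derivationOp d h (killingIn x h k) (potIn x h U k)
        (derivationOp d h (killingIn x h 0) (potIn x h U 0) f) := by
  have hE0 := congrArg (d 0) hE
  have hE1 := congrArg (d 1) hE
  have c10 : ∀ f, d 1 (d 0 f) = d 0 (d 1 f) := hcomm 1 0
  have c20 : ∀ f, d 2 (d 0 f) = d 0 (d 2 f) := hcomm 2 0
  have c21 : ∀ f, d 2 (d 1 f) = d 1 (d 2 f) := hcomm 2 1
  have h00 : d 0 (x 0) = 1 := by simp [hx]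
  have h11 : d 1 (x 1) = 1 := by simp [hx]
  have h22 : d 2 (x 2) = 1 := by simp [hx]
  have h01 : d 0 (x 1) = 0 := by simp [hx]
  have h02 : d 0 (x 2) = 0 := by simp [hx]
  have h10 : d 1 (x 0) = 0 := by simp [hx]
  have h12 : d 1 (x 2) = 0 := by simp [hx]
  have h20 : d 2 (x 0) = 0 := by simp [hx]
  have h21 : d 2 (x 1) = 0 := by simp [hx]
  have h1 : ∀ i, d i (1 : A) = 0 := fun i => (d i).map_one_eq_zero
  have h2 : ∀ i, d i (2 : A) = 0 := fun i => (d i).map_natCast 2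
  simp only [map_add, map_neg, Derivation.leibniz, smul_eq_mul, h2, h00, h01, h10, h11, c10,
    neg_mul, mul_zero, mul_one, add_zero] at hE0 hE1
  obtain rfl | rfl | rfl | rfl : k = 1 ∨ k = 2 ∨ k = 3 ∨ k = 4 := by omega
  all_goals
    simp only [killingIn, potIn, derivationOp, Fin.sum_univ_three, Matrix.one_apply, Matrix.of_apply,
      Matrix.cons_val, map_add, map_neg, map_zero, Derivation.leibniz, smul_eq_mul, pow_two,
      h1, h2, hh, hU, c10, c20, c21, h00, h01, h02, h10, h11, h12, h20, h21, h22, reduceIte,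
      zero_mul, mul_zero, mul_one, one_mul, add_zero, zero_add, Fin.reduceEq, neg_zero, neg_mul]
  · linear_combination (2 * h * (x 0 * d 0 f + x 1 * d 1 f) + 2 * h * f) * hE
      + h * f * x 0 * hE0 + h * f * x 1 * hE1
  · ring
  · linear_combination (2 * h * (x 0 * d 0 f + x 1 * d 1 f + x 2 * d 2 f) + 3 * h * f) * hE
      + h * f * x 0 * hE0 + h * f * x 1 * hE1
  · linear_combination 2 * h * h * d 2 f * hE

end algebra

/-- The algebra of smooth complex functions on the set `Ω`. -/
def smoothFun (Ω : Set E3) : Subalgebra ℂ (Ω → ℂ) where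
  carrier := {f | ∃ g : E3 → ℂ, ContDiffOn ℝ ∞ g Ω ∧ ∀ x : Ω, f x = g x}
  mul_mem' := by
    rintro _ _ ⟨g, hg, h⟩ ⟨g', hg', h'⟩
    exact ⟨fun x => g x * g' x, hg.mul hg', fun x => by simp [h, h']⟩
  add_mem' := by
    rintro _ _ ⟨g, hg, h⟩ ⟨g', hg', h'⟩
    exact ⟨fun x => g x + g' x, hg.add hg', fun x => by simp [h, h']⟩
  algebraMap_mem' c := ⟨fun _ => c, contDiffOn_const, fun _ => rfl⟩

namespace smoothFun

variable {Ω : Set E3}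

/-- The restriction to `Ω` of a function that is smooth there. -/
def restrict (φ : E3 → ℂ) (hφ : ContDiffOn ℝ ∞ φ Ω) : smoothFun Ω :=
  ⟨fun x => φ x, φ, hφ, fun _ => rfl⟩

lemma exists_eq_restrict (f : smoothFun Ω) : ∃ φ hφ, f = restrict φ hφ := by
  obtain ⟨f, φ, hφ, h⟩ := f
  exact ⟨φ, hφ, Subtype.ext (funext h)⟩

lemma restrict_eq_iff {φ ψ : E3 → ℂ} {hφ : ContDiffOn ℝ ∞ φ Ω} {hψ : ContDiffOn ℝ ∞ ψ Ω} :
    restrict φ hφ = restrict ψ hψ ↔ ∀ x ∈ Ω, φ x = ψ x := by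
  simp [restrict, funext_iff, Subtype.ext_iff]

/-- A smooth function inducing the given element of `smoothFun Ω`. -/
noncomputable def lift (f : smoothFun Ω) : E3 → ℂ := f.2.choose

lemma contDiffOn_lift (f : smoothFun Ω) : ContDiffOn ℝ ∞ (lift f) Ω := f.2.choose_spec.1

lemma lift_apply (f : smoothFun Ω) {x : E3} (hx : x ∈ Ω) : (lift f) x = f.1 ⟨x, hx⟩ :=
  (f.2.choose_spec.2 ⟨x, hx⟩).symm

/-- The partial derivatives, as derivations of the algebra of smooth functions on the open
set `Ω`. -/
noncomputable def deriv (hΩ : IsOpen Ω) (i : Fin 3) : Derivation ℂ (smoothFun Ω) (smoothFun Ω) :=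
  Derivation.mk'
    { toFun := fun f => restrict (pd i (lift f)) ((contDiffOn_lift f).pd hΩ i)
      map_add' := fun f g => Subtype.ext <| funext fun x => by
        have h : ∀ y ∈ Ω, (lift (f + g)) y = (lift f) y + (lift g) y := fun y hy => by
          simp [lift_apply _ hy]
        change pd i (lift (f + g)) x = pd i (lift f) x + pd i (lift g) x
        rw [pd_congr hΩ h i x.2, pd_add ((contDiffOn_lift f).differentiableAt_of_isOpen hΩ x.2)
          ((contDiffOn_lift g).differentiableAt_of_isOpen hΩ x.2)]
      map_smul' := fun c f => Subtype.ext <| funext fun x => by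
        have h : ∀ y ∈ Ω, (lift (c • f)) y = c * (lift f) y := fun y hy => by
          simp [lift_apply _ hy]
        change pd i (lift (c • f)) x = c * pd i (lift f) x
        rw [pd_congr hΩ h i x.2, pd_mul (differentiableAt_const c)
          ((contDiffOn_lift f).differentiableAt_of_isOpen hΩ x.2), pd_const]
        simp }
    fun f g => Subtype.ext <| funext fun x => by
      have h : ∀ y ∈ Ω, (lift (f * g)) y = (lift f) y * (lift g) y := fun y hy => by
        simp [lift_apply _ hy]
      change pd i (lift (f * g)) x = f.1 x * pd i (lift g) x + g.1 x * pd i (lift f) x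
      rw [pd_congr hΩ h i x.2, pd_mul ((contDiffOn_lift f).differentiableAt_of_isOpen hΩ x.2)
        ((contDiffOn_lift g).differentiableAt_of_isOpen hΩ x.2), lift_apply f x.2, lift_apply g x.2]

lemma deriv_restrict (hΩ : IsOpen Ω) (i : Fin 3) (φ : E3 → ℂ) (hφ : ContDiffOn ℝ ∞ φ Ω) :
    deriv hΩ i (restrict φ hφ) = restrict (pd i φ) (hφ.pd hΩ i) := by
  refine Subtype.ext (funext fun x => pd_congr hΩ (fun y hy => ?_) i x.2)
  rw [lift_apply _ hy]; rfl

lemma deriv_comm (hΩ : IsOpen Ω) (i j : Fin 3) (f : smoothFun Ω) :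
    deriv hΩ i (deriv hΩ j f) = deriv hΩ j (deriv hΩ i f) := by
  obtain ⟨φ, hφ, rfl⟩ := exists_eq_restrict f
  simp only [deriv_restrict]
  exact restrict_eq_iff.2 fun x hx => pd_comm hΩ hφ i j hx

end smoothFun

lemma ContDiffOn.complex_ofReal {Ω : Set E3} {f : E3 → ℝ} (hf : ContDiffOn ℝ ∞ f Ω) :
    ContDiffOn ℝ ∞ (fun x => (f x : ℂ)) Ω :=
  Complex.ofRealCLM.contDiff.comp_contDiffOn hf

section
variable {Ω : Set E3} {K : E3 → Matrix (Fin 3) (Fin 3) ℝ} {W : E3 → ℝ}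

lemma contDiffOn_quantize (hΩ : IsOpen Ω) (hK : ∀ i j, ContDiff ℝ ∞ fun x => K x i j)
    (hW : ContDiffOn ℝ ∞ W Ω) {φ : E3 → ℂ} (hφ : ContDiffOn ℝ ∞ φ Ω) :
    ContDiffOn ℝ ∞ (quantize K W φ) Ω := by
  refine (contDiffOn_const.mul (ContDiffOn.sum fun i _ => ContDiffOn.sum fun j _ => ?_)).add
    (hW.complex_ofReal.mul hφ)
  exact ((hK i j).contDiffOn.complex_ofReal.mul (hφ.pd hΩ j)).pd hΩ i

lemma restrict_quantize (hΩ : IsOpen Ω) (hK : ∀ i j, ContDiff ℝ ∞ fun x => K x i j)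
    (hW : ContDiffOn ℝ ∞ W Ω) {φ : E3 → ℂ} (hφ : ContDiffOn ℝ ∞ φ Ω) :
    smoothFun.restrict (quantize K W φ) (contDiffOn_quantize hΩ hK hW hφ)
      = derivationOp (smoothFun.deriv hΩ) (algebraMap ℂ _ (1 / 2))
        (fun i j => smoothFun.restrict _ (hK i j).contDiffOn.complex_ofReal)
        (smoothFun.restrict _ hW.complex_ofReal) (smoothFun.restrict φ hφ) := by
  have hmul : ∀ {φ ψ : E3 → ℂ} (hφ : ContDiffOn ℝ ∞ φ Ω) (hψ : ContDiffOn ℝ ∞ ψ Ω),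
      smoothFun.restrict φ hφ * smoothFun.restrict ψ hψ
        = smoothFun.restrict (fun x => φ x * ψ x) (hφ.mul hψ) := fun _ _ => rfl
  simp only [derivationOp, smoothFun.deriv_restrict, hmul]
  refine Subtype.ext (funext fun x => ?_)
  simp only [smoothFun.restrict, quantize, Subalgebra.coe_add, Subalgebra.coe_mul,
    Subalgebra.coe_algebraMap, Pi.add_apply, Pi.mul_apply, Pi.algebraMap_apply, Algebra.algebraMap_self,
    RingHom.id_apply, Fin.sum_univ_three]
end

/-- The commutation of the operators follows from the algebraic identity `derivationOp_comm` in
the algebra of smooth functions on the region. -/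
lemma commuteOn_qop {F : ℝ → ℝ} {D : Set ℝ} (hD : IsOpen D)
    (hV : ∀ k, ContDiffOn ℝ ∞ (pot F k) (region D)) {k : Fin 5} (hk : k ≠ 0) :
    CommuteOn (region D) (qop F 0) (qop F k) := by
  intro φ hφ
  have hΩ := isOpen_region hD
  have hq : ∀ k {φ : E3 → ℂ}, ContDiffOn ℝ ∞ φ (region D) → ContDiffOn ℝ ∞ (qop F k φ) (region D) :=
    fun k _ h => contDiffOn_quantize hΩ (contDiff_killing k) (hV k) h
  suffices h : smoothFun.restrict _ (hq 0 (hq k hφ)) = smoothFun.restrict _ (hq k (hq 0 hφ)) from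
    smoothFun.restrict_eq_iff.1 h
  have hcoord : ∀ i : Fin 3, ContDiffOn ℝ ∞ (fun x : E3 => x i) (region D) := fun i => by fun_prop
  let X : Fin 3 → smoothFun (region D) := fun i => smoothFun.restrict _ (hcoord i).complex_ofReal
  let U : smoothFun (region D) := smoothFun.restrict _ (hV 0).complex_ofReal
  have hd : ∀ x ∈ region D, DifferentiableAt ℝ (pot F 0) x := fun x hx =>
    (hV 0).differentiableAt_of_isOpen hΩ hx
  have hX : ∀ i j, smoothFun.deriv hΩ i (X j) = if i = j then 1 else 0 := by
    intro i j
    simp only [X, smoothFun.deriv_restrict]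
    refine Subtype.ext (funext fun x => ?_)
    change pd i (fun y : E3 => ((y j : ℝ) : ℂ)) x = _
    rw [pd_ofReal (by fun_prop), pd_coord]
    split_ifs <;> simp
  have hE : X 0 * smoothFun.deriv hΩ 0 U + X 1 * smoothFun.deriv hΩ 1 U = -2 * U := by
    simp only [U, smoothFun.deriv_restrict]
    refine Subtype.ext (funext fun x => ?_)
    change ((x.1 0 : ℝ) : ℂ) * pd 0 (fun y => (pot F 0 y : ℂ)) x
      + ((x.1 1 : ℝ) : ℂ) * pd 1 (fun y => (pot F 0 y : ℂ)) x = -2 * (pot F 0 x : ℂ)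
    rw [pd_ofReal (hd x x.2), pd_ofReal (hd x x.2)]
    have := congrArg ((↑) : ℝ → ℂ) (euler_pot_zero F (hd x x.2))
    push_cast at this
    exact this
  have hU : smoothFun.deriv hΩ 2 U = 0 := by
    simp only [U, smoothFun.deriv_restrict]
    refine Subtype.ext (funext fun x => ?_)
    change pd 2 (fun y => (pot F 0 y : ℂ)) x = 0
    rw [pd_ofReal (hd x x.2), pd_two_pot_zero F (hd x x.2), Complex.ofReal_zero]
  have key := derivationOp_comm (smoothFun.deriv_comm hΩ) hX
    (h := algebraMap ℂ _ (1 / 2)) (fun i => Derivation.map_algebraMap _ _) hE hU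
    (smoothFun.restrict φ hφ) k hk
  have hrad : ∀ x ∈ region D, 0 < rad x := fun x hx => rad_pos_of_mem hx
  refine (restrict_quantize hΩ (contDiff_killing 0) (hV 0) (hq k hφ)).trans ?_
  refine ((congrArg _ (restrict_quantize hΩ (contDiff_killing k) (hV k) hφ)).trans ?_).trans
    (restrict_quantize hΩ (contDiff_killing k) (hV k) (hq 0 hφ)).symm
  refine Eq.trans ?_ (congrArg _ (restrict_quantize hΩ (contDiff_killing 0) (hV 0) hφ)).symm
  have hK : ∀ k, (fun i j => smoothFun.restrict _ (contDiff_killing k i j).contDiffOn.complex_ofReal)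
      = killingIn X (algebraMap ℂ (smoothFun (region D)) (1 / 2)) k := by
    intro k
    ext i j x
    change ((killing k x i j : ℝ) : ℂ) = _
    match k with
    | 0 =>
      rw [killing_zero]
      fin_cases i <;> fin_cases j <;> simp [killingIn]
    | 1 =>
      rw [killing_one]
      fin_cases i <;> fin_cases j <;> simp [killingIn, X, smoothFun.restrict]
    | 2 =>
      rw [killing_two]
      fin_cases i <;> fin_cases j <;> simp [killingIn]
    | 3 =>
      rw [killing_three]
      fin_cases i <;> fin_cases j <;> simp [killingIn, X, smoothFun.restrict]
    | 4 =>
      have e : ((x.1 2 : ℝ) : ℂ) = 2⁻¹ * ((x.1 2 : ℝ) + (x.1 2 : ℝ)) := by ring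
      rw [killing_four]
      fin_cases i <;> fin_cases j <;>
        simp [killingIn, X, smoothFun.restrict, div_eq_inv_mul, ← e]
  have hW : ∀ k, smoothFun.restrict _ (hV k).complex_ofReal
      = potIn X (algebraMap ℂ (smoothFun (region D)) (1 / 2)) U k := by
    intro k
    ext x
    change (pot F k x : ℂ) = _
    match k with
    | 0 => rfl
    | 1 => rw [pot_one_eq F (hrad x x.2)]; simp [potIn, X, U, smoothFun.restrict]
    | 2 => simp [potIn, pot]
    | 3 => rw [pot_three_eq F (hrad x x.2)]; simp [potIn, X, U, smoothFun.restrict]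
    | 4 =>
      have e : ((x.1 2 : ℝ) : ℂ) = 2⁻¹ * ((x.1 2 : ℝ) + (x.1 2 : ℝ)) := by ring
      rw [pot_four_eq F x]
      simp [potIn, X, U, smoothFun.restrict, ← e]
  rw [hK, hK, hW, hW]
  exact key

/-! ### Linear differential equations on an interval -/

section linearODE
open MeasureTheory intervalIntegral BoundedContinuousFunction

variable {E : Type*} [NormedAddCommGroup E] {I : Set ℝ} {t₀ t : ℝ}
lemma ContinuousOn.intervalIntegrable_of_ordConnected {g : ℝ → E} (hg : ContinuousOn g I)
    (hI : I.OrdConnected) (h₀ : t₀ ∈ I) (ht : t ∈ I) : IntervalIntegrable g volume t₀ t :=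
  (hg.mono (hI.uIcc_subset h₀ ht)).intervalIntegrable

variable [NormedSpace ℝ E]

lemma ContinuousOn.hasDerivAt_integral [CompleteSpace E] {g : ℝ → E} (hg : ContinuousOn g I)
    (hIo : IsOpen I) (hI : I.OrdConnected) (h₀ : t₀ ∈ I) (ht : t ∈ I) :
    HasDerivAt (fun u => ∫ s in t₀..u, g s) (g t) t :=
  integral_hasDerivAt_right (hg.intervalIntegrable_of_ordConnected hI h₀ ht)
    (hg.stronglyMeasurableAtFilter hIo t ht) (hg.continuousAt (hIo.mem_nhds ht))

/-- The weight `exp (2 |∫ k|)` dominates twice the integral of `k` times itself, in both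
directions from `t₀`. -/
lemma abs_integral_mul_exp_le {k : ℝ → ℝ} (hk : ContinuousOn k I) (hk0 : ∀ t, 0 ≤ k t)
    (hIo : IsOpen I) (hI : I.OrdConnected) (h₀ : t₀ ∈ I) (ht : t ∈ I) :
    |∫ s in t₀..t, k s * Real.exp (2 * |∫ r in t₀..s, k r|)|
      ≤ Real.exp (2 * |∫ r in t₀..t, k r|) / 2 := by
  set S : ℝ → ℝ := fun s => ∫ r in t₀..s, k r with hS
  -- `c = ±1` is the side of `t₀` on which `t` lies
  obtain ⟨c, hc, habs⟩ : ∃ c : ℝ, c * c = 1 ∧ ∀ s ∈ Set.uIcc t₀ t, |S s| = c * S s := by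
    rcases le_total t₀ t with h | h
    · refine ⟨1, by norm_num, fun s hs => ?_⟩
      rw [Set.uIcc_of_le h] at hs
      rw [one_mul, abs_of_nonneg (integral_nonneg hs.1 fun r _ => hk0 r)]
    · refine ⟨-1, by norm_num, fun s hs => ?_⟩
      rw [Set.uIcc_of_ge h] at hs
      have : S s ≤ 0 := by
        rw [hS]; dsimp only; rw [integral_symm, neg_nonpos]
        exact integral_nonneg hs.2 fun r _ => hk0 r
      rw [abs_of_nonpos this]; ring
  have hsub := hI.uIcc_subset h₀ ht
  have hd : ∀ s ∈ Set.uIcc t₀ t,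
      HasDerivAt (fun s => c / 2 * Real.exp (2 * (c * S s))) (k s * Real.exp (2 * |S s|)) s := by
    intro s hs
    have h1 := hk.hasDerivAt_integral hIo hI h₀ (hsub hs)
    have h2 := (((h1.const_mul c).const_mul 2).exp).const_mul (c / 2)
    refine h2.congr_deriv ?_
    rw [habs s hs]
    linear_combination Real.exp (2 * (c * S s)) * k s * hc
  have hcont : ContinuousOn (fun s => k s * Real.exp (2 * |S s|)) I := by
    have : ContinuousOn S I := fun s hs =>
      (hk.hasDerivAt_integral hIo hI h₀ hs).continuousAt.continuousWithinAt
    fun_prop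
  rw [integral_eq_sub_of_hasDerivAt hd (hcont.intervalIntegrable_of_ordConnected hI h₀ ht),
    habs t Set.right_mem_uIcc]
  have h0 : S t₀ = 0 := integral_same
  have h1 : 1 ≤ Real.exp (2 * (c * S t)) := by
    rw [← habs t Set.right_mem_uIcc]
    exact Real.one_le_exp (by positivity)
  have habsc : |c| = 1 := by
    have : |c| * |c| = 1 := by rw [← abs_mul, hc, abs_one]
    nlinarith [abs_nonneg c]
  rw [h0, mul_zero, mul_zero, Real.exp_zero, ← mul_sub, abs_mul, abs_div, habsc, abs_two,
    abs_of_nonneg (by linarith)]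
  linarith

/-- A linear equation `y' = A(t) y` with continuous coefficients on an open interval has a solution
on the whole interval. With the weight `m = exp (2 |∫ ‖A‖|)` the integral equation for `w = y / m`
is a contraction of the space of bounded continuous functions on the interval, so that no
continuation argument is needed. -/
theorem exists_hasDerivAt_linear [CompleteSpace E] (hIo : IsOpen I) (hI : I.OrdConnected)
    {A : ℝ → E →L[ℝ] E} (hA : ContinuousOn A I) (h₀ : t₀ ∈ I) (y₀ : E) :
    ∃ y : ℝ → E, y t₀ = y₀ ∧ ∀ t ∈ I, HasDerivAt y (A t (y t)) t := by
  classical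
  set m : ℝ → ℝ := fun t => Real.exp (2 * |∫ r in t₀..t, ‖A r‖|) with hm
  have hmpos : ∀ t, 0 < m t := fun t => Real.exp_pos _
  have hm1 : ∀ t, 1 ≤ m t := fun t => Real.one_le_exp (by positivity)
  have hmc : ContinuousOn m I := by
    have : ContinuousOn (fun t => ∫ r in t₀..t, ‖A r‖) I := fun s hs =>
      (hA.norm.hasDerivAt_integral hIo hI h₀ hs).continuousAt.continuousWithinAt
    fun_prop
  have hAc : ∀ {u : ℝ → E}, ContinuousOn u I → ContinuousOn (fun s => A s (m s • u s)) I :=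
    fun hu => hA.clm_apply (hmc.smul hu)
  have hbound : ∀ {u : ℝ → E} {C : ℝ}, (∀ s ∈ I, ‖u s‖ ≤ C) → ∀ t ∈ I,
      ‖(m t)⁻¹ • ∫ s in t₀..t, A s (m s • u s)‖ ≤ C / 2 := by
    intro u C huC t ht
    have hC : 0 ≤ C := (norm_nonneg _).trans (huC t ht)
    have hsub := hI.uIcc_subset h₀ ht
    have h1 : ‖∫ s in t₀..t, A s (m s • u s)‖ ≤ |∫ s in t₀..t, ‖A s‖ * m s * C| := by
      refine norm_integral_le_abs_of_norm_le ?_ ?_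
      · refine (ae_restrict_iff' measurableSet_uIoc).2 (Eventually.of_forall fun s hs => ?_)
        have hsI := hsub (Set.uIoc_subset_uIcc hs)
        calc ‖A s (m s • u s)‖ ≤ ‖A s‖ * ‖m s • u s‖ := (A s).le_opNorm _
          _ = ‖A s‖ * m s * ‖u s‖ := by
            rw [norm_smul, Real.norm_of_nonneg (hmpos s).le, mul_assoc]
          _ ≤ ‖A s‖ * m s * C := by
            have := hmpos s
            gcongr
            exact huC s hsI
      · exact ((hA.norm.mul hmc).mul continuousOn_const).intervalIntegrable_of_ordConnected
          hI h₀ ht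
    have h2 := abs_integral_mul_exp_le hA.norm (fun t => norm_nonneg (A t)) hIo hI h₀ ht
    rw [intervalIntegral.integral_mul_const, abs_mul, abs_of_nonneg hC] at h1
    rw [norm_smul, norm_inv, Real.norm_of_nonneg (hmpos t).le, inv_mul_le_iff₀ (hmpos t)]
    calc _ ≤ _ := h1
      _ ≤ m t / 2 * C := by gcongr
      _ = _ := by ring
  let ext : (I →ᵇ E) → ℝ → E := fun w s => if h : s ∈ I then w ⟨s, h⟩ else 0
  have hext : ∀ w (s : I), ext w s = w s := fun w s => by simp [ext]
  have hextc : ∀ w, ContinuousOn (ext w) I := fun w =>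
    continuousOn_iff_continuous_domRestrict.2 <| by
      convert w.continuous using 1
      funext s
      exact hext w s
  let P : (I →ᵇ E) → ℝ → E := fun w t => (m t)⁻¹ • (y₀ + ∫ s in t₀..t, A s (m s • ext w s))
  have hPc : ∀ w, ContinuousOn (P w) I := by
    intro w
    refine (hmc.inv₀ fun t _ => (hmpos t).ne').smul (continuousOn_const.add fun s hs => ?_)
    exact ((hAc (hextc w)).hasDerivAt_integral hIo hI h₀ hs).continuousAt.continuousWithinAt
  let Φ : (I →ᵇ E) → (I →ᵇ E) := fun w =>
    BoundedContinuousFunction.ofNormedAddCommGroup (fun t : I => P w t)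
      (continuousOn_iff_continuous_domRestrict.1 (hPc w)) (‖y₀‖ + ‖w‖ / 2) (by
        intro t
        simp only [P, smul_add]
        refine (norm_add_le _ _).trans (add_le_add ?_ (hbound (fun s hs => ?_) t t.2))
        · rw [norm_smul, norm_inv, Real.norm_of_nonneg (hmpos t).le]
          exact mul_le_of_le_one_left (norm_nonneg _) (inv_le_one_of_one_le₀ (hm1 t))
        · rw [hext w ⟨s, hs⟩]; exact w.norm_coe_le_norm _)
  have hcontr : ContractingWith 2⁻¹ Φ := by
    refine ⟨by rw [← NNReal.coe_lt_coe]; norm_num, LipschitzWith.of_dist_le_mul fun w w' => ?_⟩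
    have hC : ((2⁻¹ : NNReal) : ℝ) * dist w w' = dist w w' / 2 := by
      push_cast; ring
    rw [hC, BoundedContinuousFunction.dist_le (by positivity)]
    intro t
    have h := hbound (u := fun s => ext w s - ext w' s) (C := dist w w') (fun s hs => by
      rw [hext w ⟨s, hs⟩, hext w' ⟨s, hs⟩, ← dist_eq_norm]
      exact BoundedContinuousFunction.dist_coe_le_dist _) t t.2
    have hint : ∀ w, IntervalIntegrable (fun s => A s (m s • ext w s)) volume t₀ t := fun w =>
      (hAc (hextc w)).intervalIntegrable_of_ordConnected hI h₀ t.2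
    simp only [smul_sub, map_sub] at h
    rw [integral_sub (hint w) (hint w')] at h
    change dist (P w t) (P w' t) ≤ _
    rw [dist_eq_norm]
    have e : P w t - P w' t = (m t)⁻¹ • ((∫ s in t₀..t, A s (m s • ext w s))
        - ∫ s in t₀..t, A s (m s • ext w' s)) := by
      simp only [P]
      rw [← smul_sub, add_sub_add_left_eq_sub]
    rwa [e]
  set w := hcontr.fixedPoint Φ with hw
  have hfix : ∀ t ∈ I, m t • ext w t = y₀ + ∫ s in t₀..t, A s (m s • ext w s) := by
    intro t ht
    have h1 : w ⟨t, ht⟩ = P w t := by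
      conv_lhs => rw [hw, ← hcontr.fixedPoint_isFixedPt]
      rfl
    rw [hext w ⟨t, ht⟩, h1]
    simp only [P]
    rw [smul_inv_smul₀ (hmpos t).ne']
  refine ⟨fun t => m t • ext w t, by simp [hfix t₀ h₀], fun t ht => ?_⟩
  have h1 := ((hAc (hextc w)).hasDerivAt_integral hIo hI h₀ ht).const_add y₀
  refine h1.congr_of_eventuallyEq ?_
  filter_upwards [hIo.mem_nhds ht] with s hs using hfix s hs

lemma contDiffOn_of_hasDerivAt_linear (hIo : IsOpen I) {A : ℝ → E →L[ℝ] E}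
    (hA : ContDiffOn ℝ ∞ A I) {y : ℝ → E} (hy : ∀ t ∈ I, HasDerivAt y (A t (y t)) t) :
    ContDiffOn ℝ ∞ y I := by
  refine contDiffOn_infty.2 fun n => ?_
  induction n with
  | zero =>
    exact contDiffOn_zero.2 fun t ht => (hy t ht).continuousAt.continuousWithinAt
  | succ n ih =>
    push_cast
    refine (contDiffOn_succ_iff_deriv_of_isOpen hIo).2
      ⟨fun t ht => (hy t ht).differentiableAt.differentiableWithinAt, by simp, ?_⟩
    exact ((hA.of_le (by exact_mod_cast le_top)).clm_apply ih).congr fun t ht => (hy t ht).deriv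

/-- Second order scalar linear equations have smooth solutions with arbitrary initial slope. -/
lemma exists_contDiffOn_second_order (hIo : IsOpen I) (hI : I.OrdConnected) {c m : ℝ → ℂ}
    (hc : ContDiffOn ℝ ∞ c I) (hm : ContDiffOn ℝ ∞ m I) (h₀ : t₀ ∈ I) (u : ℂ) :
    ∃ f : ℝ → ℂ, ContDiffOn ℝ ∞ f I ∧ f t₀ = 1 ∧ deriv f t₀ = u ∧
      ∀ t ∈ I, deriv (deriv f) t = m t * f t - c t * deriv f t := by
  let p : ℂ × ℂ →L[ℝ] ℂ := ContinuousLinearMap.fst ℝ ℂ ℂ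
  let q : ℂ × ℂ →L[ℝ] ℂ := ContinuousLinearMap.snd ℝ ℂ ℂ
  let i : ℂ →L[ℝ] ℂ × ℂ := ContinuousLinearMap.inl ℝ ℂ ℂ
  let j : ℂ →L[ℝ] ℂ × ℂ := ContinuousLinearMap.inr ℝ ℂ ℂ
  -- the companion system of the equation
  let A : ℝ → (ℂ × ℂ) →L[ℝ] (ℂ × ℂ) := fun t => i.comp q + m t • j.comp p - c t • j.comp q
  have hA : ContDiffOn ℝ ∞ A I :=
    (contDiffOn_const.add (hm.smul contDiffOn_const)).sub (hc.smul contDiffOn_const)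
  obtain ⟨y, hy₀, hy⟩ := exists_hasDerivAt_linear hIo hI hA.continuousOn h₀ (1, u)
  have hys := contDiffOn_of_hasDerivAt_linear hIo hA hy
  have h1 : ∀ t ∈ I, HasDerivAt (fun t => (y t).1) (y t).2 t := fun t ht =>
    (p.hasFDerivAt.comp_hasDerivAt t (hy t ht)).congr_deriv (by simp [A, p, q, i, j])
  have h2 : ∀ t ∈ I, HasDerivAt (fun t => (y t).2) (m t * (y t).1 - c t * (y t).2) t :=
    fun t ht => (q.hasFDerivAt.comp_hasDerivAt t (hy t ht)).congr_deriv (by simp [A, p, q, i, j])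
  refine ⟨fun t => (y t).1, hys.fst, by simp [hy₀], by rw [(h1 _ h₀).deriv, hy₀], fun t ht => ?_⟩
  have h3 : deriv (fun t => (y t).1) =ᶠ[𝓝 t] fun t => (y t).2 := by
    filter_upwards [hIo.mem_nhds ht] with s hs using (h1 s hs).deriv
  rw [h3.deriv_eq, (h2 t ht).deriv, (h1 t ht).deriv]

end linearODE

/-! ### The Laplacian along coordinate curves -/

/-- The first two derivatives of a smooth function along a curve with velocity `v` and
acceleration `w`. -/
lemma deriv_comp_curve {U : Set E3} (hU : IsOpen U) {φ : E3 → ℂ} (hφ : ContDiffOn ℝ ∞ φ U)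
    {γ v : ℝ → E3} {w : E3} {t : ℝ} (hγ : ∀ s, HasDerivAt γ (v s) s) (hv : HasDerivAt v w t)
    (ht : γ t ∈ U) :
    deriv (φ ∘ γ) t = ∑ k, ((v t k : ℝ) : ℂ) * pd k φ (γ t) ∧
      deriv (deriv (φ ∘ γ)) t = ∑ k, (((w k : ℝ) : ℂ) * pd k φ (γ t)
        + ∑ l, ((v t k * v t l : ℝ) : ℂ) * pd l (pd k φ) (γ t)) := by
  have h1 : ∀ {ψ : E3 → ℂ}, ContDiffOn ℝ ∞ ψ U → ∀ s, γ s ∈ U →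
      HasDerivAt (ψ ∘ γ) (∑ k, ((v s k : ℝ) : ℂ) * pd k ψ (γ s)) s := by
    intro ψ hψ s hs
    have := (hψ.differentiableAt_of_isOpen hU hs).hasFDerivAt.comp_hasDerivAt s (hγ s)
    rw [fderiv_eq_sum_pd] at this
    simpa only [Complex.real_smul] using this
  refine ⟨(h1 hφ t ht).deriv, ?_⟩
  have h2 : deriv (φ ∘ γ) =ᶠ[𝓝 t] fun s => ∑ k, ((v s k : ℝ) : ℂ) * pd k φ (γ s) := by
    filter_upwards [(hγ t).continuousAt.eventually_mem (hU.mem_nhds ht)] with s hs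
    exact (h1 hφ s hs).deriv
  rw [h2.deriv_eq]
  refine HasDerivAt.deriv ?_
  refine HasDerivAt.fun_sum fun k _ => ?_
  have h3 : HasDerivAt (fun s => ((v s k : ℝ) : ℂ)) ((w k : ℝ) : ℂ) t := by
    have := (EuclideanSpace.proj k : E3 →L[ℝ] ℝ).hasFDerivAt.comp_hasDerivAt t hv
    exact (Complex.ofRealCLM.hasFDerivAt.comp_hasDerivAt t this)
  refine (h3.mul (h1 (hφ.pd hU k) t ht)).congr_deriv ?_
  simp only [Function.comp, Finset.mul_sum, Complex.ofReal_mul, mul_assoc]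

lemma qop_zero_eq (F : ℝ → ℝ) {U : Set E3} (hU : IsOpen U) {φ : E3 → ℂ}
    (hφ : ContDiffOn ℝ ∞ φ U) {x : E3} (hx : x ∈ U) :
    qop F 0 φ x = 1 / 2 * ∑ i, pd i (pd i φ) x + (pot F 0 x : ℂ) * φ x := by
  rw [qop, quantize_eq (contDiff_killing 0) _ hU hφ hx]
  simp only [killing_zero, Fin.sum_univ_three]
  simp [pd_const]

/-- If the coordinate vectors `e i`, rescaled by `√(g i)`, form an orthonormal frame, and the
accelerations `w i` of the coordinate lines satisfy `∑ gᵢ (wᵢ + cᵢ eᵢ) = 0`, then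
`Δ = ∑ gᵢ (∂ᵢ² + cᵢ ∂ᵢ)`. -/
lemma laplacian_eq_sum {U : Set E3} (hU : IsOpen U) {φ : E3 → ℂ} (hφ : ContDiffOn ℝ ∞ φ U)
    {γ v : Fin 3 → ℝ → E3} {w : Fin 3 → E3} {q : Fin 3 → ℝ} {x : E3} {g c : Fin 3 → ℝ}
    (hγ : ∀ i s, HasDerivAt (γ i) (v i s) s) (hv : ∀ i, HasDerivAt (v i) (w i) (q i))
    (hx : x ∈ U) (hγx : ∀ i, γ i (q i) = x)
    (hg : ∀ k l, ∑ i, g i * v i (q i) k * v i (q i) l = if k = l then 1 else 0)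
    (hw : ∀ k, ∑ i, g i * (w i k + c i * v i (q i) k) = 0) :
    ∑ i, (g i : ℂ) * (deriv (deriv (φ ∘ γ i)) (q i) + (c i : ℂ) * deriv (φ ∘ γ i) (q i))
      = ∑ i, pd i (pd i φ) x := by
  have h := fun i => deriv_comp_curve hU hφ (hγ i) (hv i) (by rwa [hγx i])
  simp only [(h _).1, (h _).2, hγx]
  have hg' : ∀ k l, ∑ i, (g i : ℂ) * (v i (q i) k : ℝ) * (v i (q i) l : ℝ)
      = if k = l then 1 else 0 := fun k l => by
    rw [← Complex.ofReal_one, ← Complex.ofReal_zero, ← apply_ite, ← hg k l]; push_cast; rfl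
  have hw' : ∀ k, ∑ i, (g i : ℂ) * ((w i k : ℝ) + c i * (v i (q i) k : ℝ)) = 0 := fun k => by
    rw [← Complex.ofReal_zero, ← hw k]; push_cast; rfl
  have e1 : ∑ i, pd i (pd i φ) x = ∑ k, ∑ l, (if k = l then 1 else 0) * pd l (pd k φ) x := by
    simp
  rw [e1]
  simp only [← hg']
  have e2 : ∑ k, (∑ i, (g i : ℂ) * ((w i k : ℝ) + c i * (v i (q i) k : ℝ))) * pd k φ x = 0 := by
    simp only [hw', zero_mul, Finset.sum_const_zero]
  simp only [Fin.sum_univ_three, Complex.ofReal_mul] at e2 ⊢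
  linear_combination e2

/-! ### Local inversion on coordinate boxes -/

/-- An injective smooth map with invertible derivatives on an open set has open image and a smooth
inverse. -/
lemma exists_smooth_inverse {X : (Fin 3 → ℝ) → E3} {B : Set (Fin 3 → ℝ)} (hB : IsOpen B)
    (hX : ContDiffOn ℝ ∞ X B) (hinj : Set.InjOn X B)
    (hder : ∀ q ∈ B, Function.Injective (fderiv ℝ X q)) :
    IsOpen (X '' B) ∧ ∃ Y : E3 → Fin 3 → ℝ, ContDiffOn ℝ ∞ Y (X '' B) ∧ ∀ q ∈ B, Y (X q) = q := by
  have hequiv : ∀ q ∈ B, ∃ e : (Fin 3 → ℝ) ≃L[ℝ] E3, (e : (Fin 3 → ℝ) →L[ℝ] E3) = fderiv ℝ X q := by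
    intro q hq
    have hdim : Module.finrank ℝ (Fin 3 → ℝ) = Module.finrank ℝ E3 := by simp
    refine ⟨(LinearEquiv.ofInjectiveOfFinrankEq (fderiv ℝ X q).toLinearMap (hder q hq)
      hdim).toContinuousLinearEquiv, ?_⟩
    ext v
    rfl
  have hat : ∀ q ∈ B, ContDiffAt ℝ ∞ X q := fun q hq => hX.contDiffAt (hB.mem_nhds hq)
  have hopen : IsOpenMap (B.domRestrict X) := by
    refine IsOpenMap.of_nhds_le fun q => ?_
    obtain ⟨e, he⟩ := hequiv q q.2
    have h1 : HasStrictFDerivAt X (e : (Fin 3 → ℝ) →L[ℝ] E3) q := by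
      rw [he]; exact (hat q q.2).hasStrictFDerivAt (by simp)
    have h2 : map (B.domRestrict X) (𝓝 q) = map X (𝓝 (q : Fin 3 → ℝ)) := by
      rw [← map_nhds_subtype_coe_eq_nhds q.2 (hB.mem_nhds q.2), Filter.map_map]; rfl
    rw [h2, h1.map_nhds_eq_of_equiv]
    rfl
  let P := OpenPartialHomeomorph.ofContinuousOpenRestrict (hinj.toPartialEquiv) hX.continuousOn hopen hB
  refine ⟨P.open_target, P.symm, fun x hx => ?_, fun q hq => P.left_inv hq⟩
  have hmem : P.symm x ∈ B := P.map_target hx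
  obtain ⟨e, he⟩ := hequiv _ hmem
  refine (P.contDiffAt_symm (f₀' := e) hx ?_ (hat _ hmem)).contDiffWithinAt
  rw [he]
  exact ((hat _ hmem).differentiableAt (by simp)).hasFDerivAt

/-! ### Separable systems of rotational coordinates -/

/-- Orthogonal coordinates `(s, t)` on an open part `S` of the half-plane of points at distance
`ρ s t > 0` from the axis and at height `ζ s t`, with the data that make the rotational coordinates
they induce separable. The `g i` are the inverse squares of the lengths of the coordinate vectors,
`gᵢ (∂ᵢ² + cᵢ ∂ᵢ)` are the coordinate parts of the Laplacian, and `A`, `B`, `C` are the rows of the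
Stäckel matrix: the separated equations `fᵢ'' + cᵢ fᵢ' = (2 E Aᵢ + μ Bᵢ + ν Cᵢ) fᵢ`, `i = 0, 1`,
with an angular equation with constant `-μ`, combine to the eigenvalue equation. -/
structure SeparableProfile (ρ ζ : ℝ → ℝ → ℝ) (S : Set (ℝ × ℝ)) where
  /-- The derivatives `∂ₛ ρ`, `∂ₜ ρ`. -/
  (ρs ρt : ℝ → ℝ → ℝ)
  /-- The derivatives `∂ₛ² ρ`, `∂ₜ² ρ`. -/
  (ρss ρtt : ℝ → ℝ → ℝ)
  /-- The derivatives `∂ₛ ζ`, `∂ₜ ζ`. -/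
  (ζs ζt : ℝ → ℝ → ℝ)
  /-- The derivatives `∂ₛ² ζ`, `∂ₜ² ζ`. -/
  (ζss ζtt : ℝ → ℝ → ℝ)
  /-- The inverse squared lengths of the coordinate vectors. -/
  (g₀ g₁ : ℝ → ℝ → ℝ)
  /-- The coefficients of the first order terms of the separated equations. -/
  (c₀ c₁ : ℝ → ℝ)
  /-- The functions multiplying the separation constants. -/
  (A₀ A₁ B₀ B₁ C₀ C₁ : ℝ → ℝ)
  isOpen : IsOpen S
  contDiff_ρ : ContDiff ℝ ∞ fun p : ℝ × ℝ => ρ p.1 p.2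
  contDiff_ζ : ContDiff ℝ ∞ fun p : ℝ × ℝ => ζ p.1 p.2
  pos : ∀ s t, (s, t) ∈ S → 0 < ρ s t
  hρs : ∀ s t, HasDerivAt (fun s => ρ s t) (ρs s t) s
  hρt : ∀ s t, HasDerivAt (ρ s) (ρt s t) t
  hζs : ∀ s t, HasDerivAt (fun s => ζ s t) (ζs s t) s
  hζt : ∀ s t, HasDerivAt (ζ s) (ζt s t) t
  hρss : ∀ s t, HasDerivAt (fun s => ρs s t) (ρss s t) s
  hρtt : ∀ s t, HasDerivAt (ρt s) (ρtt s t) t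
  hζss : ∀ s t, HasDerivAt (fun s => ζs s t) (ζss s t) s
  hζtt : ∀ s t, HasDerivAt (ζt s) (ζtt s t) t
  orth : ∀ s t, (s, t) ∈ S → ρs s t * ρt s t + ζs s t * ζt s t = 0
  norm₀ : ∀ s t, (s, t) ∈ S → g₀ s t * (ρs s t ^ 2 + ζs s t ^ 2) = 1
  norm₁ : ∀ s t, (s, t) ∈ S → g₁ s t * (ρt s t ^ 2 + ζt s t ^ 2) = 1
  laplacian_ρ : ∀ s t, (s, t) ∈ S →
    g₀ s t * (ρss s t + c₀ s * ρs s t) + g₁ s t * (ρtt s t + c₁ t * ρt s t) = 1 / ρ s t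
  laplacian_ζ : ∀ s t, (s, t) ∈ S →
    g₀ s t * (ζss s t + c₀ s * ζs s t) + g₁ s t * (ζtt s t + c₁ t * ζt s t) = 0
  staeckel_A : ∀ s t, (s, t) ∈ S → g₀ s t * A₀ s + g₁ s t * A₁ t = 1
  staeckel_B : ∀ s t, (s, t) ∈ S → g₀ s t * B₀ s + g₁ s t * B₁ t = 1 / ρ s t ^ 2
  staeckel_C : ∀ s t, (s, t) ∈ S → g₀ s t * C₀ s + g₁ s t * C₁ t = 0
  C₀_ne : ∀ s t, (s, t) ∈ S → C₀ s ≠ 0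
  smooth₀ : ∀ s t, (s, t) ∈ S → ContDiffAt ℝ ∞ c₀ s ∧ ContDiffAt ℝ ∞ A₀ s ∧ ContDiffAt ℝ ∞ B₀ s ∧
    ContDiffAt ℝ ∞ C₀ s
  smooth₁ : ∀ s t, (s, t) ∈ S → ContDiffAt ℝ ∞ c₁ t ∧ ContDiffAt ℝ ∞ A₁ t ∧ ContDiffAt ℝ ∞ B₁ t ∧
    ContDiffAt ℝ ∞ C₁ t

/-- The rotational coordinates with the given profile in the half-plane. -/
noncomputable def rotCoord (ρ ζ : ℝ → ℝ → ℝ) (q : Fin 3 → ℝ) : E3 :=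
  cyl (ρ (q 0) (q 1)) (q 2) (ζ (q 0) (q 1))

lemma hasDerivAt_euclidean {a b c : ℝ → ℝ} {a' b' c' t : ℝ} (ha : HasDerivAt a a' t)
    (hb : HasDerivAt b b' t) (hc : HasDerivAt c c' t) :
    HasDerivAt (fun t => (!₂[a t, b t, c t] : E3)) !₂[a', b', c'] t := by
  have h : HasDerivAt (fun t => ![a t, b t, c t]) ![a', b', c'] t := by
    refine hasDerivAt_pi.2 fun i => ?_
    fin_cases i <;> assumption
  exact (PiLp.continuousLinearEquiv 2 ℝ fun _ : Fin 3 => ℝ).symm.hasFDerivAt.comp_hasDerivAt t h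

namespace SeparableProfile

variable {ρ ζ : ℝ → ℝ → ℝ} {S : Set (ℝ × ℝ)}

lemma contDiff_rotCoord (P : SeparableProfile ρ ζ S) : ContDiff ℝ ∞ (rotCoord ρ ζ) := by
  have hq : ∀ i : Fin 3, ContDiff ℝ ∞ fun q : Fin 3 → ℝ => q i := fun i => contDiff_apply ℝ ℝ i
  have hρ : ContDiff ℝ ∞ fun q : Fin 3 → ℝ => ρ (q 0) (q 1) :=
    P.contDiff_ρ.comp ((hq 0).prodMk (hq 1))
  have hζ : ContDiff ℝ ∞ fun q : Fin 3 → ℝ => ζ (q 0) (q 1) :=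
    P.contDiff_ζ.comp ((hq 0).prodMk (hq 1))
  refine contDiff_euclidean.2 fun i => ?_
  fin_cases i
  · exact hρ.mul (Real.contDiff_cos.comp (hq 2))
  · exact hρ.mul (Real.contDiff_sin.comp (hq 2))
  · exact hζ

variable (P : SeparableProfile ρ ζ S)

lemma g₁_ne {s t : ℝ} (h : (s, t) ∈ S) : P.g₁ s t ≠ 0 := fun h0 => by
  simpa [h0] using P.norm₁ s t h

/-- The dual form of orthonormality: `g₀ eₛ eₛᵀ + g₁ eₜ eₜᵀ = 1`. -/
lemma dual_orth {s t : ℝ} (h : (s, t) ∈ S) :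
    P.g₀ s t * P.ρs s t ^ 2 + P.g₁ s t * P.ρt s t ^ 2 = 1 ∧
    P.g₀ s t * P.ζs s t ^ 2 + P.g₁ s t * P.ζt s t ^ 2 = 1 ∧
    P.g₀ s t * P.ρs s t * P.ζs s t + P.g₁ s t * P.ρt s t * P.ζt s t = 0 := by
  have ho := P.orth s t h
  have h0 := P.norm₀ s t h
  have h1 := P.norm₁ s t h
  have hM : !![P.g₀ s t * P.ρs s t, P.g₀ s t * P.ζs s t; P.g₁ s t * P.ρt s t, P.g₁ s t * P.ζt s t]
      * !![P.ρs s t, P.ρt s t; P.ζs s t, P.ζt s t] = (1 : Matrix (Fin 2) (Fin 2) ℝ) := by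
    ext i j
    fin_cases i <;> fin_cases j <;> simp [Matrix.mul_apply, Fin.sum_univ_two]
    · linear_combination h0
    · linear_combination P.g₀ s t * ho
    · linear_combination P.g₁ s t * ho
    · linear_combination h1
  have hN := mul_eq_one_comm.1 hM
  have h00 := congrFun (congrFun hN 0) 0
  have h01 := congrFun (congrFun hN 0) 1
  have h11 := congrFun (congrFun hN 1) 1
  simp [Matrix.mul_apply, Fin.sum_univ_two] at h00 h01 h11
  exact ⟨by linear_combination h00, by linear_combination h11, by linear_combination h01⟩

/-- The coordinate vectors. -/
noncomputable def vec (q : Fin 3 → ℝ) : Fin 3 → E3 :=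
  ![!₂[P.ρs (q 0) (q 1) * Real.cos (q 2), P.ρs (q 0) (q 1) * Real.sin (q 2), P.ζs (q 0) (q 1)],
    !₂[P.ρt (q 0) (q 1) * Real.cos (q 2), P.ρt (q 0) (q 1) * Real.sin (q 2), P.ζt (q 0) (q 1)],
    !₂[-(ρ (q 0) (q 1) * Real.sin (q 2)), ρ (q 0) (q 1) * Real.cos (q 2), 0]]

/-- The accelerations of the coordinate lines. -/
noncomputable def acc (q : Fin 3 → ℝ) : Fin 3 → E3 :=
  ![!₂[P.ρss (q 0) (q 1) * Real.cos (q 2), P.ρss (q 0) (q 1) * Real.sin (q 2), P.ζss (q 0) (q 1)],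
    !₂[P.ρtt (q 0) (q 1) * Real.cos (q 2), P.ρtt (q 0) (q 1) * Real.sin (q 2), P.ζtt (q 0) (q 1)],
    !₂[-(ρ (q 0) (q 1) * Real.cos (q 2)), -(ρ (q 0) (q 1) * Real.sin (q 2)), 0]]

lemma hasDerivAt_coord (q : Fin 3 → ℝ) (i : Fin 3) (s : ℝ) :
    HasDerivAt (fun s => rotCoord ρ ζ (Function.update q i s))
      (P.vec (Function.update q i s) i) s := by
  fin_cases i
  · exact hasDerivAt_euclidean ((P.hρs s (q 1)).mul_const (Real.cos (q 2))) ((P.hρs s (q 1)).mul_const (Real.sin (q 2)))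
      (P.hζs s (q 1))
  · exact hasDerivAt_euclidean ((P.hρt (q 0) s).mul_const (Real.cos (q 2))) ((P.hρt (q 0) s).mul_const (Real.sin (q 2)))
      (P.hζt (q 0) s)
  · have := hasDerivAt_euclidean ((Real.hasDerivAt_cos s).const_mul (ρ (q 0) (q 1)))
      ((Real.hasDerivAt_sin s).const_mul (ρ (q 0) (q 1))) (hasDerivAt_const s (ζ (q 0) (q 1)))
    rw [mul_neg] at this
    exact this

lemma hasDerivAt_vec (q : Fin 3 → ℝ) (i : Fin 3) :
    HasDerivAt (fun s => P.vec (Function.update q i s) i) (P.acc q i) (q i) := by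
  fin_cases i
  · exact hasDerivAt_euclidean ((P.hρss (q 0) (q 1)).mul_const (Real.cos (q 2)))
      ((P.hρss (q 0) (q 1)).mul_const (Real.sin (q 2))) (P.hζss (q 0) (q 1))
  · exact hasDerivAt_euclidean ((P.hρtt (q 0) (q 1)).mul_const (Real.cos (q 2)))
      ((P.hρtt (q 0) (q 1)).mul_const (Real.sin (q 2))) (P.hζtt (q 0) (q 1))
  · have := hasDerivAt_euclidean ((Real.hasDerivAt_sin (q 2)).const_mul (ρ (q 0) (q 1))).neg
      ((Real.hasDerivAt_cos (q 2)).const_mul (ρ (q 0) (q 1))) (hasDerivAt_const (q 2) (0 : ℝ))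
    rw [mul_neg] at this
    exact this

lemma fderiv_rotCoord (q : Fin 3 → ℝ) (i : Fin 3) :
    fderiv ℝ (rotCoord ρ ζ) q (Pi.single i 1) = P.vec q i := by
  have h1 := P.hasDerivAt_coord q i (q i)
  rw [Function.update_eq_self] at h1
  have h2 : HasFDerivAt (rotCoord ρ ζ) (fderiv ℝ (rotCoord ρ ζ) q) (Function.update q i (q i)) := by
    rw [Function.update_eq_self]
    exact ((P.contDiff_rotCoord.differentiable (by simp)) q).hasFDerivAt
  exact (h2.comp_hasDerivAt (q i) (hasDerivAt_update q i (q i))).unique h1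

lemma inner_vec {q : Fin 3 → ℝ} (hq : (q 0, q 1) ∈ S) {i j : Fin 3} (hij : i ≠ j) :
    inner ℝ (P.vec q i) (P.vec q j) = 0 := by
  have ho := P.orth _ _ hq
  have hcs := Real.cos_sq_add_sin_sq (q 2)
  fin_cases i <;> fin_cases j <;> first | exact absurd rfl hij | skip
  all_goals simp [vec, PiLp.inner_apply, Fin.sum_univ_three]
  · linear_combination ho + P.ρs (q 0) (q 1) * P.ρt (q 0) (q 1) * hcs
  · ring
  · linear_combination ho + P.ρs (q 0) (q 1) * P.ρt (q 0) (q 1) * hcs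
  · ring
  · ring
  · ring

lemma vec_ne_zero {q : Fin 3 → ℝ} (hq : (q 0, q 1) ∈ S) (i : Fin 3) : P.vec q i ≠ 0 := by
  have hcs := Real.cos_sq_add_sin_sq (q 2)
  intro h
  have h0 : ∑ k, P.vec q i k * P.vec q i k = 0 := by rw [h]; simp
  rw [Fin.sum_univ_three] at h0
  obtain rfl | rfl | rfl : i = 0 ∨ i = 1 ∨ i = 2 := by omega
  · have h1 : P.ρs (q 0) (q 1) ^ 2 + P.ζs (q 0) (q 1) ^ 2 = 0 := by
      simp only [vec, Matrix.cons_val] at h0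
      linear_combination h0 - P.ρs (q 0) (q 1) ^ 2 * hcs
    simpa [h1] using P.norm₀ _ _ hq
  · have h1 : P.ρt (q 0) (q 1) ^ 2 + P.ζt (q 0) (q 1) ^ 2 = 0 := by
      simp only [vec, Matrix.cons_val] at h0
      linear_combination h0 - P.ρt (q 0) (q 1) ^ 2 * hcs
    simpa [h1] using P.norm₁ _ _ hq
  · have h1 : ρ (q 0) (q 1) ^ 2 = 0 := by
      simp only [vec, Matrix.cons_val] at h0
      linear_combination h0 - ρ (q 0) (q 1) ^ 2 * hcs
    exact (P.pos _ _ hq).ne' (pow_eq_zero_iff two_ne_zero |>.1 h1)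

lemma fderiv_injective (P : SeparableProfile ρ ζ S) {q : Fin 3 → ℝ} (hq : (q 0, q 1) ∈ S) :
    Function.Injective (fderiv ℝ (rotCoord ρ ζ) q) := by
  refine (injective_iff_map_eq_zero _).2 fun v hv => ?_
  have hsum : ∑ i, v i • P.vec q i = 0 := by
    have e : v = ∑ i, v i • Pi.single i (1 : ℝ) := by
      ext j
      simp [Finset.sum_apply, Pi.single_apply]
    rw [← hv]
    conv_rhs => rw [e]
    simp only [map_sum, map_smul, P.fderiv_rotCoord]
  funext j
  have := congrArg (fun w : E3 => inner ℝ w (P.vec q j)) hsum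
  simp only [sum_inner, inner_smul_left, inner_zero_left] at this
  rw [Finset.sum_eq_single j (fun i _ hij => by rw [P.inner_vec hq hij, mul_zero]) (by simp)] at this
  simpa [P.vec_ne_zero hq j] using this

end SeparableProfile

namespace SeparableProfile

variable {ρ ζ : ℝ → ℝ → ℝ} {S : Set (ℝ × ℝ)}

lemma isOrthogonalCoords (P : SeparableProfile ρ ζ S) {D : Set ℝ} (hD : IsOpen D) :
    IsOrthogonalCoords (rotCoord ρ ζ) {q | (q 0, q 1) ∈ S ∧ q 2 ∈ D} := by
  refine ⟨?_, P.contDiff_rotCoord.contDiffOn, fun q hq => ⟨fun i => ?_, fun i j hij => ?_⟩⟩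
  · have h : Continuous fun q : Fin 3 → ℝ => (q 0, q 1) := by fun_prop
    exact (P.isOpen.preimage h).inter (hD.preimage (continuous_apply 2))
  · rw [P.fderiv_rotCoord]; exact P.vec_ne_zero hq.1 i
  · rw [P.fderiv_rotCoord, P.fderiv_rotCoord]; exact P.inner_vec hq.1 hij

/-- The Laplacian in the coordinates of a separable profile. -/
lemma laplacian_rotCoord (P : SeparableProfile ρ ζ S) {U : Set E3} (hU : IsOpen U) {φ : E3 → ℂ}
    (hφ : ContDiffOn ℝ ∞ φ U) {q : Fin 3 → ℝ} (hq : (q 0, q 1) ∈ S) (hx : rotCoord ρ ζ q ∈ U) :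
    let Φ : Fin 3 → ℝ → ℂ := fun i s => φ (rotCoord ρ ζ (Function.update q i s))
    (P.g₀ (q 0) (q 1) : ℂ) * (deriv (deriv (Φ 0)) (q 0) + (P.c₀ (q 0) : ℂ) * deriv (Φ 0) (q 0))
      + (P.g₁ (q 0) (q 1) : ℂ) * (deriv (deriv (Φ 1)) (q 1) + (P.c₁ (q 1) : ℂ) * deriv (Φ 1) (q 1))
      + ((1 / ρ (q 0) (q 1) ^ 2 : ℝ) : ℂ) * deriv (deriv (Φ 2)) (q 2)
      = ∑ i, pd i (pd i φ) (rotCoord ρ ζ q) := by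
  intro Φ
  obtain ⟨d1, d2, d3⟩ := P.dual_orth hq
  have hρ := (P.pos _ _ hq).ne'
  have hr : 1 / ρ (q 0) (q 1) ^ 2 * ρ (q 0) (q 1) ^ 2 = 1 := by field_simp
  have hcs := Real.cos_sq_add_sin_sq (q 2)
  have l1 := P.laplacian_ρ _ _ hq
  have l2 := P.laplacian_ζ _ _ hq
  have key := laplacian_eq_sum hU hφ (γ := fun i s => rotCoord ρ ζ (Function.update q i s))
    (v := fun i s => P.vec (Function.update q i s) i) (w := P.acc q) (q := q)
    (g := ![P.g₀ (q 0) (q 1), P.g₁ (q 0) (q 1), 1 / ρ (q 0) (q 1) ^ 2])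
    (c := ![P.c₀ (q 0), P.c₁ (q 1), 0]) (P.hasDerivAt_coord q) (P.hasDerivAt_vec q) hx
    (fun i => by rw [Function.update_eq_self]) ?_ ?_
  · rw [← key, Fin.sum_univ_three]
    simp [Φ, Function.comp_def]
  · intro k l
    simp only [Function.update_eq_self, Fin.sum_univ_three, vec, Matrix.cons_val]
    obtain rfl | rfl | rfl : k = 0 ∨ k = 1 ∨ k = 2 := by omega
    all_goals obtain rfl | rfl | rfl : l = 0 ∨ l = 1 ∨ l = 2 := by omega
    all_goals simp only [Matrix.cons_val, reduceIte, Fin.reduceEq]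
    · linear_combination Real.cos (q 2) ^ 2 * d1 + Real.sin (q 2) ^ 2 * hr + hcs
    · linear_combination Real.cos (q 2) * Real.sin (q 2) * (d1 - hr)
    · linear_combination Real.cos (q 2) * d3
    · linear_combination Real.cos (q 2) * Real.sin (q 2) * (d1 - hr)
    · linear_combination Real.sin (q 2) ^ 2 * d1 + Real.cos (q 2) ^ 2 * hr + hcs
    · linear_combination Real.sin (q 2) * d3
    · linear_combination Real.cos (q 2) * d3
    · linear_combination Real.sin (q 2) * d3
    · linear_combination d2
  · intro k
    simp only [Function.update_eq_self, Fin.sum_univ_three, vec, acc, Matrix.cons_val]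
    obtain rfl | rfl | rfl : k = 0 ∨ k = 1 ∨ k = 2 := by omega
    all_goals simp only [Matrix.cons_val]
    · have : 1 / ρ (q 0) (q 1) ^ 2 * ρ (q 0) (q 1) = 1 / ρ (q 0) (q 1) := by field_simp
      linear_combination Real.cos (q 2) * l1 - Real.cos (q 2) * this
    · have : 1 / ρ (q 0) (q 1) ^ 2 * ρ (q 0) (q 1) = 1 / ρ (q 0) (q 1) := by field_simp
      linear_combination Real.sin (q 2) * l1 - Real.sin (q 2) * this
    · linear_combination l2

/-- Separability: the separation constants `E`, `μ`, `ν` are determined by the prescribed second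
derivatives because the Stäckel matrix is invertible, and the separated equations, being linear,
have solutions on the whole coordinate intervals. -/
lemma multiplicativelySeparable (P : SeparableProfile ρ ζ S) {F : ℝ → ℝ} {D : Set ℝ}
    (hper : Function.Periodic F (2 * Real.pi)) (hF : ContDiffOn ℝ ∞ F D) :
    MultiplicativelySeparable (qop F 0) (rotCoord ρ ζ) {q | (q 0, q 1) ∈ S ∧ q 2 ∈ D} := by
  intro I hI hQ hinj q₀ hq₀ u v
  have hmem : ∀ i, q₀ i ∈ I i := fun i => hq₀ i (Set.mem_univ i)
  set B : Set (Fin 3 → ℝ) := Set.univ.pi I with hBdef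
  have hB : IsOpen B := isOpen_set_pi Set.finite_univ fun i _ => (hI i).1
  have hupd : ∀ q ∈ B, ∀ i, ∀ s ∈ I i, Function.update q i s ∈ B := by
    intro q hq i s hs j _
    rcases eq_or_ne j i with rfl | h
    · rwa [Function.update_self]
    · rw [Function.update_of_ne h]; exact hq j (Set.mem_univ j)
  -- the separation constants
  set S₀ := (q₀ 0, q₀ 1) with hS₀
  have hS : S₀ ∈ S := (hQ hq₀).1
  let M₀ : ℂ := v 0 + P.c₀ (q₀ 0) * u 0
  let M₁ : ℂ := v 1 + P.c₁ (q₀ 1) * u 1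
  let μ : ℂ := -(2 * F (q₀ 2) : ℝ) - v 2
  let E : ℂ := (P.g₀ (q₀ 0) (q₀ 1) * (M₀ - μ * P.B₀ (q₀ 0))
    + P.g₁ (q₀ 0) (q₀ 1) * (M₁ - μ * P.B₁ (q₀ 1))) / 2
  let ν : ℂ := (M₀ - μ * P.B₀ (q₀ 0) - 2 * E * P.A₀ (q₀ 0)) / P.C₀ (q₀ 0)
  let m₀ : ℝ → ℂ := fun s => 2 * E * P.A₀ s + μ * P.B₀ s + ν * P.C₀ s
  let m₁ : ℝ → ℂ := fun t => 2 * E * P.A₁ t + μ * P.B₁ t + ν * P.C₁ t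
  let m₂ : ℝ → ℂ := fun ψ => -(2 * F ψ : ℝ) - μ
  have hm₀ : m₀ (q₀ 0) = M₀ := by
    have : (P.C₀ (q₀ 0) : ℂ) ≠ 0 := by exact_mod_cast P.C₀_ne _ _ hS
    simp only [m₀, ν]
    field_simp
    ring
  have hm₁ : m₁ (q₀ 1) = M₁ := by
    have hA : (P.g₀ (q₀ 0) (q₀ 1) : ℂ) * P.A₀ (q₀ 0) + P.g₁ (q₀ 0) (q₀ 1) * P.A₁ (q₀ 1) = 1 := by
      exact_mod_cast P.staeckel_A _ _ hS
    have hC : (P.g₀ (q₀ 0) (q₀ 1) : ℂ) * P.C₀ (q₀ 0) + P.g₁ (q₀ 0) (q₀ 1) * P.C₁ (q₀ 1) = 0 := by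
      exact_mod_cast P.staeckel_C _ _ hS
    have hg : (P.g₁ (q₀ 0) (q₀ 1) : ℂ) ≠ 0 := by exact_mod_cast P.g₁_ne hS
    have hE : 2 * E = P.g₀ (q₀ 0) (q₀ 1) * (M₀ - μ * P.B₀ (q₀ 0))
      + P.g₁ (q₀ 0) (q₀ 1) * (M₁ - μ * P.B₁ (q₀ 1)) := by simp only [E]; ring
    have hm : 2 * E * P.A₀ (q₀ 0) + μ * P.B₀ (q₀ 0) + ν * P.C₀ (q₀ 0) = M₀ := hm₀
    refine mul_left_cancel₀ hg ?_
    change (P.g₁ (q₀ 0) (q₀ 1) : ℂ) * (2 * E * P.A₁ (q₀ 1) + μ * P.B₁ (q₀ 1) + ν * P.C₁ (q₀ 1)) = _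
    linear_combination 2 * E * hA + ν * hC + hE - P.g₀ (q₀ 0) (q₀ 1) * hm
  have hm₂ : m₂ (q₀ 2) = v 2 := by simp only [m₂, μ]; ring
  -- smoothness of the coefficients
  have hIS : ∀ s ∈ I 0, ∀ t ∈ I 1, (s, t) ∈ S := by
    intro s hs t ht
    exact (hQ (hupd _ (hupd _ hq₀ 0 s hs) 1 t ht)).1
  have hID : ∀ ψ ∈ I 2, ψ ∈ D := fun ψ hψ => by
    have := (hQ (hupd _ hq₀ 2 ψ hψ)).2
    simpa using this
  have cast : ∀ {f : ℝ → ℝ} {s : ℝ}, ContDiffAt ℝ ∞ f s → ContDiffAt ℝ ∞ (fun s => (f s : ℂ)) s :=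
    fun h => Complex.ofRealCLM.contDiff.contDiffAt.comp _ h
  have hs₀ : ContDiffOn ℝ ∞ (fun s => (P.c₀ s : ℂ)) (I 0) ∧ ContDiffOn ℝ ∞ m₀ (I 0) := by
    refine ⟨fun s hs => ?_, fun s hs => ?_⟩ <;>
      obtain ⟨h1, h2, h3, h4⟩ := P.smooth₀ s _ (hIS s hs _ (hmem 1))
    · exact (cast h1).contDiffWithinAt
    · exact (((contDiffAt_const.mul (cast h2)).add (contDiffAt_const.mul (cast h3))).add
        (contDiffAt_const.mul (cast h4))).contDiffWithinAt
  have hs₁ : ContDiffOn ℝ ∞ (fun s => (P.c₁ s : ℂ)) (I 1) ∧ ContDiffOn ℝ ∞ m₁ (I 1) := by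
    refine ⟨fun t ht => ?_, fun t ht => ?_⟩ <;>
      obtain ⟨h1, h2, h3, h4⟩ := P.smooth₁ _ t (hIS _ (hmem 0) t ht)
    · exact (cast h1).contDiffWithinAt
    · exact (((contDiffAt_const.mul (cast h2)).add (contDiffAt_const.mul (cast h3))).add
        (contDiffAt_const.mul (cast h4))).contDiffWithinAt
  have hs₂ : ContDiffOn ℝ ∞ m₂ (I 2) := by
    refine ContDiffOn.sub (ContDiffOn.neg ?_) contDiffOn_const
    exact Complex.ofRealCLM.contDiff.comp_contDiffOn (contDiffOn_const.mul (hF.mono hID))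
  -- the separated equations
  obtain ⟨f₀, hf₀, hf₀1, hf₀u, hf₀'⟩ :=
    exists_contDiffOn_second_order (hI 0).1 (hI 0).2 hs₀.1 hs₀.2 (hmem 0) (u 0)
  obtain ⟨f₁, hf₁, hf₁1, hf₁u, hf₁'⟩ :=
    exists_contDiffOn_second_order (hI 1).1 (hI 1).2 hs₁.1 hs₁.2 (hmem 1) (u 1)
  obtain ⟨f₂, hf₂, hf₂1, hf₂u, hf₂'⟩ :=
    exists_contDiffOn_second_order (hI 2).1 (hI 2).2 contDiffOn_const hs₂ (c := 0) (hmem 2) (u 2)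
  let f : Fin 3 → ℝ → ℂ := ![f₀, f₁, f₂]
  have hf : ∀ i, ContDiffOn ℝ ∞ (f i) (I i) := by
    intro i; fin_cases i <;> assumption
  obtain ⟨hopen, Y, hY, hYX⟩ := exists_smooth_inverse hB P.contDiff_rotCoord.contDiffOn hinj
    fun q hq => P.fderiv_injective (hQ hq).1
  let φ : E3 → ℂ := fun x => ∏ i, f i (Y x i)
  have hφX : ∀ q ∈ B, φ (rotCoord ρ ζ q) = ∏ i, f i (q i) := fun q hq => by
    simp only [φ, hYX q hq]
  have hφ : ContDiffOn ℝ ∞ φ (rotCoord ρ ζ '' B) := by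
    refine contDiffOn_prod fun i _ => ?_
    refine (hf i).comp ((contDiff_apply ℝ ℝ i).comp_contDiffOn hY) ?_
    rintro _ ⟨q, hq, rfl⟩
    simpa only [Function.comp, hYX q hq] using hq i (Set.mem_univ i)
  refine ⟨E, f, φ, fun i => ⟨hf i, ?_⟩, hφX, hφ, ?_⟩
  · obtain rfl | rfl | rfl : i = 0 ∨ i = 1 ∨ i = 2 := by omega
    · refine ⟨hf₀1, hf₀u, (hf₀' _ (hmem 0)).trans ?_⟩
      rw [hf₀1, hf₀u, hm₀]; simp only [M₀]; ring
    · refine ⟨hf₁1, hf₁u, (hf₁' _ (hmem 1)).trans ?_⟩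
      rw [hf₁1, hf₁u, hm₁]; simp only [M₁]; ring
    · refine ⟨hf₂1, hf₂u, (hf₂' _ (hmem 2)).trans ?_⟩
      rw [hf₂1, hf₂u, hm₂]; simp
  rintro _ ⟨q, hq, rfl⟩
  have hqi : ∀ i, q i ∈ I i := fun i => hq i (Set.mem_univ i)
  have hqS := (hQ hq).1
  rw [qop_zero_eq F hopen hφ ⟨q, hq, rfl⟩,
    ← P.laplacian_rotCoord hopen hφ hqS ⟨q, hq, rfl⟩, hφX q hq]
  have hΦ : ∀ i (d : ℂ), (∀ s, ∏ j, f j (Function.update q i s j) = f i s * d) →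
      deriv (fun s => φ (rotCoord ρ ζ (Function.update q i s))) (q i) = deriv (f i) (q i) * d ∧
      deriv (deriv (fun s => φ (rotCoord ρ ζ (Function.update q i s)))) (q i)
        = deriv (deriv (f i)) (q i) * d := by
    intro i d hd
    have h1 : (fun s => φ (rotCoord ρ ζ (Function.update q i s))) =ᶠ[𝓝 (q i)] fun s => f i s * d := by
      filter_upwards [(hI i).1.mem_nhds (hqi i)] with s hs
      rw [hφX _ (hupd q hq i s hs), hd]
    have h2 : ∀ {g : ℝ → ℂ}, deriv (fun s => g s * d) = fun s => deriv g s * d :=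
      funext fun s => deriv_mul_const_field _
    refine ⟨by rw [h1.deriv_eq, h2], ?_⟩
    rw [h1.deriv.deriv_eq, h2, h2]
  obtain ⟨e01, e02⟩ := hΦ 0 (f₁ (q 1) * f₂ (q 2)) (fun s => by
    simp [Fin.prod_univ_three, f, mul_assoc])
  obtain ⟨e11, e12⟩ := hΦ 1 (f₀ (q 0) * f₂ (q 2)) (fun s => by
    simp [Fin.prod_univ_three, f]; ring)
  obtain ⟨e21, e22⟩ := hΦ 2 (f₀ (q 0) * f₁ (q 1)) (fun s => by
    simp [Fin.prod_univ_three, f]; ring)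
  simp only [e01, e02, e11, e12, e22]
  have hpot : pot F 0 (rotCoord ρ ζ q) = F (q 2) / ρ (q 0) (q 1) ^ 2 := by
    simp only [pot, rotCoord, Matrix.cons_val_zero]
    rw [hper.apply_ang_cyl (P.pos _ _ hqS), rad_cyl (P.pos _ _ hqS).le]
  have hA : (P.g₀ (q 0) (q 1) : ℂ) * P.A₀ (q 0) + P.g₁ (q 0) (q 1) * P.A₁ (q 1) = 1 := by
    exact_mod_cast P.staeckel_A _ _ hqS
  have hC : (P.g₀ (q 0) (q 1) : ℂ) * P.C₀ (q 0) + P.g₁ (q 0) (q 1) * P.C₁ (q 1) = 0 := by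
    exact_mod_cast P.staeckel_C _ _ hqS
  have hBB : (P.g₀ (q 0) (q 1) : ℂ) * P.B₀ (q 0) + P.g₁ (q 0) (q 1) * P.B₁ (q 1)
      = 1 / (ρ (q 0) (q 1) : ℂ) ^ 2 := by
    exact_mod_cast P.staeckel_B _ _ hqS
  have k0 : deriv (deriv f₀) (q 0) = (2 * E * P.A₀ (q 0) + μ * P.B₀ (q 0) + ν * P.C₀ (q 0)) * f₀ (q 0)
      - P.c₀ (q 0) * deriv f₀ (q 0) := hf₀' _ (hqi 0)
  have k1 : deriv (deriv f₁) (q 1) = (2 * E * P.A₁ (q 1) + μ * P.B₁ (q 1) + ν * P.C₁ (q 1)) * f₁ (q 1)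
      - P.c₁ (q 1) * deriv f₁ (q 1) := hf₁' _ (hqi 1)
  have k2 : deriv (deriv f₂) (q 2) = (-(2 * F (q 2) : ℝ) - μ) * f₂ (q 2) := by
    have := hf₂' _ (hqi 2)
    simpa [m₂] using this
  rw [hpot, Fin.prod_univ_three]
  simp only [f, Matrix.cons_val, k0, k1, k2]
  push_cast
  linear_combination f₀ (q 0) * f₁ (q 1) * f₂ (q 2) * (E * hA + ν / 2 * hC + μ / 2 * hBB)

end SeparableProfile

/-! ### The five rotational systems -/

/-- Circular cylindrical coordinates. -/
noncomputable def cylindricalProfile (a : ℝ) :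
    SeparableProfile (RotWeb.radial a .cylindrical) (RotWeb.height a .cylindrical)
      RotWeb.cylindrical.dom where
  ρs _ _ := 1
  ρt _ _ := 0
  ρss _ _ := 0
  ρtt _ _ := 0
  ζs _ _ := 0
  ζt _ _ := 1
  ζss _ _ := 0
  ζtt _ _ := 0
  g₀ _ _ := 1
  g₁ _ _ := 1
  c₀ s := 1 / s
  c₁ _ := 0
  A₀ _ := 1
  A₁ _ := 0
  B₀ s := 1 / s ^ 2
  B₁ _ := 0
  C₀ _ := -1
  C₁ _ := 1
  isOpen := isOpen_lt continuous_const continuous_fst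
  contDiff_ρ := contDiff_fst
  contDiff_ζ := contDiff_snd
  pos _ _ h := h
  hρs s _ := hasDerivAt_id s
  hρt _ t := hasDerivAt_const t _
  hζs s _ := hasDerivAt_const s _
  hζt _ t := hasDerivAt_id t
  hρss s _ := hasDerivAt_const s _
  hρtt _ t := hasDerivAt_const t _
  hζss s _ := hasDerivAt_const s _
  hζtt _ t := hasDerivAt_const t _
  orth _ _ _ := by norm_num
  norm₀ _ _ _ := by norm_num
  norm₁ _ _ _ := by norm_num
  laplacian_ρ s _ _ := by simp [RotWeb.radial]
  laplacian_ζ _ _ _ := by norm_num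
  staeckel_A _ _ _ := by norm_num
  staeckel_B _ _ _ := by simp [RotWeb.radial]
  staeckel_C _ _ _ := by norm_num
  C₀_ne _ _ _ := by norm_num
  smooth₀ s _ h := by
    have hs : s ≠ 0 := ne_of_gt h
    have hs2 : s ^ 2 ≠ 0 := pow_ne_zero 2 hs
    refine ⟨?_, ?_, ?_, ?_⟩ <;> fun_prop (disch := assumption)
  smooth₁ _ _ _ := ⟨contDiffAt_const, contDiffAt_const, contDiffAt_const, contDiffAt_const⟩

/-- Spherical coordinates. -/
noncomputable def sphericalProfile (a : ℝ) :
    SeparableProfile (RotWeb.radial a .spherical) (RotWeb.height a .spherical)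
      RotWeb.spherical.dom where
  ρs _ t := Real.sin t
  ρt s t := s * Real.cos t
  ρss _ _ := 0
  ρtt s t := s * -Real.sin t
  ζs _ t := Real.cos t
  ζt s t := s * -Real.sin t
  ζss _ _ := 0
  ζtt s t := s * -Real.cos t
  g₀ _ _ := 1
  g₁ s _ := 1 / s ^ 2
  c₀ s := 2 / s
  c₁ t := Real.cos t / Real.sin t
  A₀ _ := 1
  A₁ _ := 0
  B₀ _ := 0
  B₁ t := 1 / Real.sin t ^ 2
  C₀ s := -(1 / s ^ 2)
  C₁ _ := 1
  isOpen := (isOpen_lt continuous_const continuous_fst).inter (isOpen_Ioo.preimage continuous_snd)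
  contDiff_ρ := contDiff_fst.mul (Real.contDiff_sin.comp contDiff_snd)
  contDiff_ζ := contDiff_fst.mul (Real.contDiff_cos.comp contDiff_snd)
  pos _ _ h := mul_pos h.1 (Real.sin_pos_of_mem_Ioo h.2)
  hρs s t := ((hasDerivAt_id s).mul_const (Real.sin t)).congr_deriv (by simp)
  hρt s t := (Real.hasDerivAt_sin t).const_mul s
  hζs s t := ((hasDerivAt_id s).mul_const (Real.cos t)).congr_deriv (by simp)
  hζt s t := (Real.hasDerivAt_cos t).const_mul s
  hρss s _ := hasDerivAt_const s _
  hρtt s t := (Real.hasDerivAt_cos t).const_mul s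
  hζss s _ := hasDerivAt_const s _
  hζtt s t := (Real.hasDerivAt_sin t).neg.const_mul s
  orth _ _ _ := by ring
  norm₀ _ t _ := by linear_combination Real.sin_sq_add_cos_sq t
  norm₁ s t h := by
    have hs : s ≠ 0 := ne_of_gt h.1
    field_simp
    linear_combination Real.sin_sq_add_cos_sq t
  laplacian_ρ s t h := by
    have hs : s ≠ 0 := ne_of_gt h.1
    have ht : Real.sin t ≠ 0 := (Real.sin_pos_of_mem_Ioo h.2).ne'
    simp only [RotWeb.radial]
    field_simp
    linear_combination Real.sin_sq_add_cos_sq t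
  laplacian_ζ s t h := by
    have hs : s ≠ 0 := ne_of_gt h.1
    have ht : Real.sin t ≠ 0 := (Real.sin_pos_of_mem_Ioo h.2).ne'
    field_simp
    ring
  staeckel_A _ _ _ := by ring
  staeckel_B s t h := by
    have hs : s ≠ 0 := ne_of_gt h.1
    have ht : Real.sin t ≠ 0 := (Real.sin_pos_of_mem_Ioo h.2).ne'
    simp only [RotWeb.radial]
    field_simp
    ring
  staeckel_C _ _ _ := by ring
  C₀_ne s _ h := by
    have hs : s ≠ 0 := ne_of_gt h.1
    simp [hs]
  smooth₀ s _ h := by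
    have hs : s ≠ 0 := ne_of_gt h.1
    have hs2 : s ^ 2 ≠ 0 := pow_ne_zero 2 hs
    refine ⟨?_, ?_, ?_, ?_⟩ <;> fun_prop (disch := assumption)
  smooth₁ _ t h := by
    have ht : Real.sin t ≠ 0 := (Real.sin_pos_of_mem_Ioo h.2).ne'
    have ht2 : Real.sin t ^ 2 ≠ 0 := pow_ne_zero 2 ht
    refine ⟨?_, ?_, ?_, ?_⟩ <;> fun_prop (disch := assumption)

/-- Parabolic coordinates. -/
noncomputable def parabolicProfile (a : ℝ) :
    SeparableProfile (RotWeb.radial a .parabolic) (RotWeb.height a .parabolic)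
      RotWeb.parabolic.dom where
  ρs _ t := t
  ρt s _ := s
  ρss _ _ := 0
  ρtt _ _ := 0
  ζs s _ := s
  ζt _ t := -t
  ζss _ _ := 1
  ζtt _ _ := -1
  g₀ s t := 1 / (s ^ 2 + t ^ 2)
  g₁ s t := 1 / (s ^ 2 + t ^ 2)
  c₀ s := 1 / s
  c₁ t := 1 / t
  A₀ s := s ^ 2
  A₁ t := t ^ 2
  B₀ s := 1 / s ^ 2
  B₁ t := 1 / t ^ 2
  C₀ _ := 1
  C₁ _ := -1
  isOpen := (isOpen_lt continuous_const continuous_fst).inter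
    (isOpen_lt continuous_const continuous_snd)
  contDiff_ρ := contDiff_fst.mul contDiff_snd
  contDiff_ζ := ((contDiff_fst.pow 2).sub (contDiff_snd.pow 2)).div_const 2
  pos _ _ h := mul_pos h.1 h.2
  hρs s t := ((hasDerivAt_id s).mul_const t).congr_deriv (by simp)
  hρt s t := ((hasDerivAt_id t).const_mul s).congr_deriv (by simp)
  hζs s t := ((((hasDerivAt_id s).fun_pow 2).sub_const (t ^ 2)).div_const 2).congr_deriv (by simp)
  hζt s t := ((((hasDerivAt_id t).fun_pow 2).const_sub (s ^ 2)).div_const 2).congr_deriv (by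
    simp [neg_div])
  hρss s _ := hasDerivAt_const s _
  hρtt _ t := hasDerivAt_const t _
  hζss s _ := hasDerivAt_id s
  hζtt _ t := (hasDerivAt_id t).neg
  orth _ _ _ := by ring
  norm₀ s t h := by
    have h1 : s ^ 2 + t ^ 2 ≠ 0 := by have := h.1; positivity
    field_simp
    ring
  norm₁ s t h := by
    have h1 : s ^ 2 + t ^ 2 ≠ 0 := by have := h.1; positivity
    field_simp
  laplacian_ρ s t h := by
    have h1 : s ^ 2 + t ^ 2 ≠ 0 := by have := h.1; positivity
    have hs : s ≠ 0 := ne_of_gt h.1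
    have ht : t ≠ 0 := ne_of_gt h.2
    simp only [RotWeb.radial]
    field_simp
    ring
  laplacian_ζ s t h := by
    have hs : s ≠ 0 := ne_of_gt h.1
    have ht : t ≠ 0 := ne_of_gt h.2
    field_simp
    ring
  staeckel_A s t h := by
    have h1 : s ^ 2 + t ^ 2 ≠ 0 := by have := h.1; positivity
    field_simp
  staeckel_B s t h := by
    have h1 : s ^ 2 + t ^ 2 ≠ 0 := by have := h.1; positivity
    have hs : s ≠ 0 := ne_of_gt h.1
    have ht : t ≠ 0 := ne_of_gt h.2
    simp only [RotWeb.radial]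
    field_simp
    ring
  staeckel_C _ _ _ := by ring
  C₀_ne _ _ _ := one_ne_zero
  smooth₀ s _ h := by
    have hs : s ≠ 0 := ne_of_gt h.1
    have hs2 : s ^ 2 ≠ 0 := pow_ne_zero 2 hs
    refine ⟨?_, ?_, ?_, ?_⟩ <;> fun_prop (disch := assumption)
  smooth₁ _ t h := by
    have ht : t ≠ 0 := ne_of_gt h.2
    have ht2 : t ^ 2 ≠ 0 := pow_ne_zero 2 ht
    refine ⟨?_, ?_, ?_, ?_⟩ <;> fun_prop (disch := assumption)

/-- Prolate spheroidal coordinates. -/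
noncomputable def prolateProfile {a : ℝ} (ha : 0 < a) :
    SeparableProfile (RotWeb.radial a .prolate) (RotWeb.height a .prolate)
      RotWeb.prolate.dom where
  ρs s t := a * Real.cosh s * Real.sin t
  ρt s t := a * Real.sinh s * Real.cos t
  ρss s t := a * Real.sinh s * Real.sin t
  ρtt s t := a * Real.sinh s * -Real.sin t
  ζs s t := a * Real.sinh s * Real.cos t
  ζt s t := a * Real.cosh s * -Real.sin t
  ζss s t := a * Real.cosh s * Real.cos t
  ζtt s t := a * Real.cosh s * -Real.cos t
  g₀ s t := 1 / (a ^ 2 * (Real.sinh s ^ 2 + Real.sin t ^ 2))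
  g₁ s t := 1 / (a ^ 2 * (Real.sinh s ^ 2 + Real.sin t ^ 2))
  c₀ s := Real.cosh s / Real.sinh s
  c₁ t := Real.cos t / Real.sin t
  A₀ s := a ^ 2 * Real.sinh s ^ 2
  A₁ t := a ^ 2 * Real.sin t ^ 2
  B₀ s := 1 / Real.sinh s ^ 2
  B₁ t := 1 / Real.sin t ^ 2
  C₀ _ := 1
  C₁ _ := -1
  isOpen := (isOpen_lt continuous_const continuous_fst).inter (isOpen_Ioo.preimage continuous_snd)
  contDiff_ρ := (contDiff_const.mul (Real.contDiff_sinh.comp contDiff_fst)).mul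
    (Real.contDiff_sin.comp contDiff_snd)
  contDiff_ζ := (contDiff_const.mul (Real.contDiff_cosh.comp contDiff_fst)).mul
    (Real.contDiff_cos.comp contDiff_snd)
  pos _ _ h := mul_pos (mul_pos ha (Real.sinh_pos_iff.2 h.1)) (Real.sin_pos_of_mem_Ioo h.2)
  hρs s t := ((Real.hasDerivAt_sinh s).const_mul a).mul_const _
  hρt s t := (Real.hasDerivAt_sin t).const_mul _
  hζs s t := ((Real.hasDerivAt_cosh s).const_mul a).mul_const _
  hζt s t := (Real.hasDerivAt_cos t).const_mul _
  hρss s t := ((Real.hasDerivAt_cosh s).const_mul a).mul_const _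
  hρtt s t := (Real.hasDerivAt_cos t).const_mul _
  hζss s t := ((Real.hasDerivAt_sinh s).const_mul a).mul_const _
  hζtt s t := (Real.hasDerivAt_sin t).neg.const_mul _
  orth _ _ _ := by ring
  norm₀ s t h := by
    have h1 : Real.sinh s ^ 2 + Real.sin t ^ 2 ≠ 0 := by
      have := Real.sinh_pos_iff.2 h.1; positivity
    field_simp
    linear_combination Real.sin t ^ 2 * Real.cosh_sq s + Real.sinh s ^ 2 * Real.sin_sq_add_cos_sq t
  norm₁ s t h := by
    have h1 : Real.sinh s ^ 2 + Real.sin t ^ 2 ≠ 0 := by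
      have := Real.sinh_pos_iff.2 h.1; positivity
    field_simp
    linear_combination Real.sin t ^ 2 * Real.cosh_sq s + Real.sinh s ^ 2 * Real.sin_sq_add_cos_sq t
  laplacian_ρ s t h := by
    have h1 : Real.sinh s ^ 2 + Real.sin t ^ 2 ≠ 0 := by
      have := Real.sinh_pos_iff.2 h.1; positivity
    have hs : Real.sinh s ≠ 0 := (Real.sinh_pos_iff.2 h.1).ne'
    have ht : Real.sin t ≠ 0 := (Real.sin_pos_of_mem_Ioo h.2).ne'
    simp only [RotWeb.radial]
    field_simp
    linear_combination Real.sin t ^ 2 * Real.cosh_sq s + Real.sinh s ^ 2 * Real.sin_sq_add_cos_sq t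
  laplacian_ζ s t h := by
    have hs : Real.sinh s ≠ 0 := (Real.sinh_pos_iff.2 h.1).ne'
    have ht : Real.sin t ≠ 0 := (Real.sin_pos_of_mem_Ioo h.2).ne'
    field_simp
    ring
  staeckel_A s t h := by
    have h1 : Real.sinh s ^ 2 + Real.sin t ^ 2 ≠ 0 := by
      have := Real.sinh_pos_iff.2 h.1; positivity
    field_simp
  staeckel_B s t h := by
    have h1 : Real.sinh s ^ 2 + Real.sin t ^ 2 ≠ 0 := by
      have := Real.sinh_pos_iff.2 h.1; positivity
    have hs : Real.sinh s ≠ 0 := (Real.sinh_pos_iff.2 h.1).ne'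
    have ht : Real.sin t ≠ 0 := (Real.sin_pos_of_mem_Ioo h.2).ne'
    simp only [RotWeb.radial]
    field_simp
    ring
  staeckel_C _ _ _ := by ring
  C₀_ne _ _ _ := one_ne_zero
  smooth₀ s _ h := by
    have hs : Real.sinh s ≠ 0 := (Real.sinh_pos_iff.2 h.1).ne'
    have hs2 : Real.sinh s ^ 2 ≠ 0 := pow_ne_zero 2 hs
    refine ⟨?_, ?_, ?_, ?_⟩ <;> fun_prop (disch := assumption)
  smooth₁ _ t h := by
    have ht : Real.sin t ≠ 0 := (Real.sin_pos_of_mem_Ioo h.2).ne'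
    have ht2 : Real.sin t ^ 2 ≠ 0 := pow_ne_zero 2 ht
    refine ⟨?_, ?_, ?_, ?_⟩ <;> fun_prop (disch := assumption)

/-- Oblate spheroidal coordinates. -/
noncomputable def oblateProfile {a : ℝ} (ha : 0 < a) :
    SeparableProfile (RotWeb.radial a .oblate) (RotWeb.height a .oblate)
      RotWeb.oblate.dom where
  ρs s t := a * Real.sinh s * Real.sin t
  ρt s t := a * Real.cosh s * Real.cos t
  ρss s t := a * Real.cosh s * Real.sin t
  ρtt s t := a * Real.cosh s * -Real.sin t
  ζs s t := a * Real.cosh s * Real.cos t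
  ζt s t := a * Real.sinh s * -Real.sin t
  ζss s t := a * Real.sinh s * Real.cos t
  ζtt s t := a * Real.sinh s * -Real.cos t
  g₀ s t := 1 / (a ^ 2 * (Real.sinh s ^ 2 + Real.cos t ^ 2))
  g₁ s t := 1 / (a ^ 2 * (Real.sinh s ^ 2 + Real.cos t ^ 2))
  c₀ s := Real.sinh s / Real.cosh s
  c₁ t := Real.cos t / Real.sin t
  A₀ s := a ^ 2 * Real.sinh s ^ 2
  A₁ t := a ^ 2 * Real.cos t ^ 2
  B₀ s := -(1 / Real.cosh s ^ 2)
  B₁ t := 1 / Real.sin t ^ 2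
  C₀ _ := 1
  C₁ _ := -1
  isOpen := (isOpen_lt continuous_const continuous_fst).inter (isOpen_Ioo.preimage continuous_snd)
  contDiff_ρ := (contDiff_const.mul (Real.contDiff_cosh.comp contDiff_fst)).mul
    (Real.contDiff_sin.comp contDiff_snd)
  contDiff_ζ := (contDiff_const.mul (Real.contDiff_sinh.comp contDiff_fst)).mul
    (Real.contDiff_cos.comp contDiff_snd)
  pos s _ h := mul_pos (mul_pos ha (Real.cosh_pos s)) (Real.sin_pos_of_mem_Ioo h.2)
  hρs s t := ((Real.hasDerivAt_cosh s).const_mul a).mul_const _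
  hρt s t := (Real.hasDerivAt_sin t).const_mul _
  hζs s t := ((Real.hasDerivAt_sinh s).const_mul a).mul_const _
  hζt s t := (Real.hasDerivAt_cos t).const_mul _
  hρss s t := ((Real.hasDerivAt_sinh s).const_mul a).mul_const _
  hρtt s t := (Real.hasDerivAt_cos t).const_mul _
  hζss s t := ((Real.hasDerivAt_cosh s).const_mul a).mul_const _
  hζtt s t := (Real.hasDerivAt_sin t).neg.const_mul _
  orth _ _ _ := by ring
  norm₀ s t h := by
    have h1 : Real.sinh s ^ 2 + Real.cos t ^ 2 ≠ 0 := by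
      have := Real.sinh_pos_iff.2 h.1; positivity
    field_simp
    linear_combination Real.cos t ^ 2 * Real.cosh_sq s + Real.sinh s ^ 2 * Real.sin_sq_add_cos_sq t
  norm₁ s t h := by
    have h1 : Real.sinh s ^ 2 + Real.cos t ^ 2 ≠ 0 := by
      have := Real.sinh_pos_iff.2 h.1; positivity
    field_simp
    linear_combination Real.cos t ^ 2 * Real.cosh_sq s + Real.sinh s ^ 2 * Real.sin_sq_add_cos_sq t
  laplacian_ρ s t h := by
    have h1 : Real.sinh s ^ 2 + Real.cos t ^ 2 ≠ 0 := by
      have := Real.sinh_pos_iff.2 h.1; positivity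
    have hs : Real.cosh s ≠ 0 := (Real.cosh_pos s).ne'
    have ht : Real.sin t ≠ 0 := (Real.sin_pos_of_mem_Ioo h.2).ne'
    simp only [RotWeb.radial]
    field_simp
    linear_combination Real.cos t ^ 2 * Real.cosh_sq s + Real.sinh s ^ 2 * Real.sin_sq_add_cos_sq t
  laplacian_ζ s t h := by
    have hs : Real.cosh s ≠ 0 := (Real.cosh_pos s).ne'
    have ht : Real.sin t ≠ 0 := (Real.sin_pos_of_mem_Ioo h.2).ne'
    field_simp
    ring
  staeckel_A s t h := by
    have h1 : Real.sinh s ^ 2 + Real.cos t ^ 2 ≠ 0 := by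
      have := Real.sinh_pos_iff.2 h.1; positivity
    field_simp
  staeckel_B s t h := by
    have h1 : Real.sinh s ^ 2 + Real.cos t ^ 2 ≠ 0 := by
      have := Real.sinh_pos_iff.2 h.1; positivity
    have hs : Real.cosh s ≠ 0 := (Real.cosh_pos s).ne'
    have ht : Real.sin t ≠ 0 := (Real.sin_pos_of_mem_Ioo h.2).ne'
    simp only [RotWeb.radial]
    field_simp
    linear_combination Real.cosh_sq s - Real.sin_sq_add_cos_sq t
  staeckel_C _ _ _ := by ring
  C₀_ne _ _ _ := one_ne_zero
  smooth₀ s _ h := by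
    have hs : Real.cosh s ≠ 0 := (Real.cosh_pos s).ne'
    have hs2 : Real.cosh s ^ 2 ≠ 0 := pow_ne_zero 2 hs
    refine ⟨?_, ?_, ?_, ?_⟩ <;> fun_prop (disch := assumption)
  smooth₁ _ t h := by
    have ht : Real.sin t ≠ 0 := (Real.sin_pos_of_mem_Ioo h.2).ne'
    have ht2 : Real.sin t ^ 2 ≠ 0 := pow_ne_zero 2 ht
    refine ⟨?_, ?_, ?_, ?_⟩ <;> fun_prop (disch := assumption)

lemma RotWeb.nonempty_separableProfile (w : RotWeb) {a : ℝ} (ha : 0 < a) :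
    Nonempty (SeparableProfile (w.radial a) (w.height a) w.dom) :=
  match w with
  | .cylindrical => ⟨cylindricalProfile a⟩
  | .spherical => ⟨sphericalProfile a⟩
  | .parabolic => ⟨parabolicProfile a⟩
  | .prolate => ⟨prolateProfile ha⟩
  | .oblate => ⟨oblateProfile ha⟩

/-! ### Similarity invariants of a web -/

/-- A similarity-invariant property which some surface of a web has, some surface of every
equivalent web has. -/
lemma WebEquiv.exists_iff {P : Set E3 → Prop} (hP : ∀ (Φ : E3 ≃ᵈ E3) S, P S → P (Φ '' S))
    {𝒮 𝒯 : Set (Set E3)} (h : WebEquiv 𝒮 𝒯) : (∃ S ∈ 𝒮, P S) ↔ ∃ T ∈ 𝒯, P T := by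
  obtain ⟨Φ, rfl⟩ := h
  constructor
  · rintro ⟨S, hS, h⟩
    exact ⟨_, ⟨S, hS, rfl⟩, hP Φ S h⟩
  · rintro ⟨_, ⟨S, hS, rfl⟩, h⟩
    refine ⟨S, hS, ?_⟩
    have := hP Φ.symm _ h
    rwa [← Set.image_comp, show (Φ.symm ∘ Φ : E3 → E3) = id from funext Φ.symm_apply_apply,
      Set.image_id] at this

lemma DilationEquiv.map_midpoint (Φ : E3 ≃ᵈ E3) (x y : E3) :
    Φ (midpoint ℝ x y) = midpoint ℝ (Φ x) (Φ y) := by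
  apply eq_midpoint_of_dist_eq_half <;> simp only [Dilation.dist_eq Φ]
  · rw [dist_left_midpoint]; norm_num; ring
  · rw [dist_midpoint_right]; norm_num; ring

/-- The surface lies on a sphere. -/
def IsSpherical (S : Set E3) : Prop := ∃ c R, S ⊆ Metric.sphere c R

/-- The surface is bounded, and two of its points realise its diameter. -/
def AttainsDiam (S : Set E3) : Prop :=
  Bornology.IsBounded S ∧ ∃ x ∈ S, ∃ y ∈ S, ∀ u ∈ S, ∀ v ∈ S, dist u v ≤ dist x y

/-- Some midpoint of two points of the surface is missing from it, and some midpoint of two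
distinct points belongs to it. -/
def IsPartlyRuled (S : Set E3) : Prop :=
  (∃ x ∈ S, ∃ y ∈ S, midpoint ℝ x y ∉ S) ∧ ∃ x ∈ S, ∃ y ∈ S, x ≠ y ∧ midpoint ℝ x y ∈ S

lemma isBounded_image_dilation (Φ : E3 ≃ᵈ E3) (S : Set E3) (h : Bornology.IsBounded S) :
    Bornology.IsBounded (Φ '' S) :=
  (Dilation.lipschitz Φ).isBounded_image h

lemma IsSpherical.image (Φ : E3 ≃ᵈ E3) (S : Set E3) : IsSpherical S → IsSpherical (Φ '' S) := by
  rintro ⟨c, R, h⟩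
  refine ⟨Φ c, Dilation.ratio Φ * R, ?_⟩
  rintro _ ⟨x, hx, rfl⟩
  rw [Metric.mem_sphere, Dilation.dist_eq, Metric.mem_sphere.1 (h hx)]

lemma AttainsDiam.image (Φ : E3 ≃ᵈ E3) (S : Set E3) : AttainsDiam S → AttainsDiam (Φ '' S) := by
  rintro ⟨hb, x, hx, y, hy, h⟩
  refine ⟨isBounded_image_dilation Φ S hb, Φ x, ⟨x, hx, rfl⟩, Φ y, ⟨y, hy, rfl⟩, ?_⟩
  rintro _ ⟨u, hu, rfl⟩ _ ⟨v, hv, rfl⟩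
  simp only [Dilation.dist_eq]
  exact mul_le_mul_of_nonneg_left (h u hu v hv) (NNReal.coe_nonneg _)

lemma IsPartlyRuled.image (Φ : E3 ≃ᵈ E3) (S : Set E3) :
    IsPartlyRuled S → IsPartlyRuled (Φ '' S) := by
  rintro ⟨⟨x, hx, y, hy, h⟩, u, hu, v, hv, huv, h'⟩
  refine ⟨⟨Φ x, ⟨x, hx, rfl⟩, Φ y, ⟨y, hy, rfl⟩, ?_⟩,
    Φ u, ⟨u, hu, rfl⟩, Φ v, ⟨v, hv, rfl⟩, Φ.injective.ne huv, ?_⟩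
  · rw [← DilationEquiv.map_midpoint]
    rintro ⟨z, hz, e⟩
    exact h (Φ.injective e ▸ hz)
  · rw [← DilationEquiv.map_midpoint]
    exact ⟨_, h', rfl⟩

/-! ### Coordinate surfaces -/

lemma norm_cyl_sq (r ψ z : ℝ) : ‖cyl r ψ z‖ ^ 2 = r ^ 2 + z ^ 2 := by
  rw [EuclideanSpace.norm_sq_eq]
  simp only [Fin.sum_univ_three, cyl_apply_zero, cyl_apply_one, cyl_apply_two, Real.norm_eq_abs,
    sq_abs]
  linear_combination r ^ 2 * Real.sin_sq_add_cos_sq ψ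

lemma dist_cyl_sq (r ψ z : ℝ) (x : E3) : dist (cyl r ψ z) x ^ 2
    = (r * Real.cos ψ - x 0) ^ 2 + (r * Real.sin ψ - x 1) ^ 2 + (z - x 2) ^ 2 := by
  rw [EuclideanSpace.dist_eq, Real.sq_sqrt (by positivity)]
  simp only [Fin.sum_univ_three, cyl_apply_zero, cyl_apply_one, cyl_apply_two, Real.dist_eq,
    sq_abs]

lemma midpoint_apply_coord (x y : E3) (i : Fin 3) : midpoint ℝ x y i = (x i + y i) / 2 := by
  simp [midpoint_eq_smul_add]; ring

lemma midpoint_cyl (r r' ψ z z' : ℝ) :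
    midpoint ℝ (cyl r ψ z) (cyl r' ψ z') = cyl ((r + r') / 2) ψ ((z + z') / 2) := by
  ext i
  rw [midpoint_apply_coord]
  obtain rfl | rfl | rfl : i = 0 ∨ i = 1 ∨ i = 2 := by omega
  · simp; ring
  · simp; ring
  · simp

namespace RotWeb

/-- The coordinate surface `qⁱ = c`. -/
def surface (w : RotWeb) (a : ℝ) (i : Fin 3) (c : ℝ) : Set E3 :=
  w.coord a '' {q | q ∈ w.coordDom Set.univ ∧ q i = c}

variable {w : RotWeb} {a c : ℝ} {x : E3}

lemma mem_surface_zero : x ∈ w.surface a 0 c ↔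
    ∃ t ψ, (c, t) ∈ w.dom ∧ x = cyl (w.radial a c t) ψ (w.height a c t) := by
  constructor
  · rintro ⟨q, ⟨⟨h, -⟩, rfl⟩, rfl⟩
    exact ⟨q 1, q 2, h, rfl⟩
  · rintro ⟨t, ψ, h, rfl⟩
    exact ⟨![c, t, ψ], ⟨⟨h, trivial⟩, rfl⟩, rfl⟩

lemma mem_surface_one : x ∈ w.surface a 1 c ↔
    ∃ s ψ, (s, c) ∈ w.dom ∧ x = cyl (w.radial a s c) ψ (w.height a s c) := by
  constructor
  · rintro ⟨q, ⟨⟨h, -⟩, rfl⟩, rfl⟩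
    exact ⟨q 0, q 2, h, rfl⟩
  · rintro ⟨s, ψ, h, rfl⟩
    exact ⟨![s, c, ψ], ⟨⟨h, trivial⟩, rfl⟩, rfl⟩

lemma mem_surface_two : x ∈ w.surface a 2 c ↔
    ∃ s t, (s, t) ∈ w.dom ∧ x = cyl (w.radial a s t) c (w.height a s t) := by
  constructor
  · rintro ⟨q, ⟨⟨h, -⟩, rfl⟩, rfl⟩
    exact ⟨q 0, q 1, h, rfl⟩
  · rintro ⟨s, t, h, rfl⟩
    exact ⟨![s, t, c], ⟨⟨h, trivial⟩, rfl⟩, rfl⟩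

lemma surface_mem_surfaces {i : Fin 3} (h : (w.surface a i c).Nonempty) :
    w.surface a i c ∈ w.surfaces a := ⟨h, i, c, rfl⟩

lemma mem_dom_of_mem_dom {s t s' : ℝ} (h : (s, t) ∈ w.dom) (hs' : 0 < s') : (s', t) ∈ w.dom := by
  cases w
  · exact hs'
  all_goals exact ⟨hs', h.2⟩

lemma tendsto_radial (ha : 0 < a) {s t : ℝ} (h : (s, t) ∈ w.dom) :
    Tendsto (fun s' => w.radial a s' t) atTop atTop := by
  have hsinh : Tendsto Real.sinh atTop atTop :=
    tendsto_atTop_mono' _ ((eventually_ge_atTop 0).mono fun _ => Real.self_le_sinh_iff.2) tendsto_id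
  cases w
  · exact tendsto_id
  · exact tendsto_id.atTop_mul_const (Real.sin_pos_of_mem_Ioo h.2)
  · exact tendsto_id.atTop_mul_const h.2
  · exact (Tendsto.const_mul_atTop ha hsinh).atTop_mul_const (Real.sin_pos_of_mem_Ioo h.2)
  · exact (Tendsto.const_mul_atTop ha (tendsto_atTop_mono (fun s => (Real.sinh_lt_cosh s).le)
      hsinh)).atTop_mul_const (Real.sin_pos_of_mem_Ioo h.2)

lemma not_isBounded_of_tendsto {S : Set E3} {r z : ℝ → ℝ} {ψ : ℝ}
    (hS : ∀ s, 0 < s → cyl (r s) ψ (z s) ∈ S)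
    (h : Tendsto r atTop atTop ∨ Tendsto z atTop atTop) : ¬ Bornology.IsBounded S := by
  intro hb
  obtain ⟨R, hR⟩ := isBounded_iff_forall_norm_le.1 hb
  rcases h with h | h
  all_goals
    obtain ⟨s, hs, hs'⟩ := ((h.eventually_gt_atTop (max R 0)).and (eventually_gt_atTop 0)).exists
    have h1 := hR _ (hS s hs')
    have h2 := norm_cyl_sq (r s) ψ (z s)
    obtain ⟨h3, h4⟩ := max_lt_iff.1 hs
    have h5 := norm_nonneg (cyl (r s) ψ (z s))
    nlinarith [sq_nonneg (r s), sq_nonneg (z s)]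

lemma not_isBounded_surface (ha : 0 < a) {i : Fin 3} (hi : i ≠ 0)
    (hne : (w.surface a i c).Nonempty) : ¬ Bornology.IsBounded (w.surface a i c) := by
  obtain ⟨x, hx⟩ := hne
  obtain rfl | rfl : i = 1 ∨ i = 2 := by omega
  · obtain ⟨s, ψ, h, -⟩ := mem_surface_one.1 hx
    exact not_isBounded_of_tendsto (ψ := ψ) (z := fun s' => w.height a s' c)
      (fun s' hs' => mem_surface_one.2 ⟨s', ψ, mem_dom_of_mem_dom h hs', rfl⟩)
      (.inl (tendsto_radial ha h))
  · obtain ⟨s, t, h, -⟩ := mem_surface_two.1 hx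
    exact not_isBounded_of_tendsto (z := fun s' => w.height a s' t)
      (fun s' hs' => mem_surface_two.2 ⟨s', t, mem_dom_of_mem_dom h hs', rfl⟩)
      (.inl (tendsto_radial ha h))

/-- In the spherical and spheroidal webs exactly the spheres and ellipsoids are bounded; the
cylindrical and parabolic webs have no bounded surface. -/
lemma exists_isBounded_iff (w : RotWeb) {a : ℝ} (ha : 0 < a) :
    (∃ S ∈ w.surfaces a, Bornology.IsBounded S) ↔ w ≠ cylindrical ∧ w ≠ parabolic := by
  constructor
  · rintro ⟨_, ⟨hne, i, c, rfl⟩, hb⟩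
    obtain rfl : i = 0 := by
      by_contra hi
      exact not_isBounded_surface ha hi hne hb
    obtain ⟨x, hx⟩ := hne
    obtain ⟨t, ψ, h, -⟩ := mem_surface_zero.1 hx
    constructor <;> rintro rfl
    · exact not_isBounded_of_tendsto (r := fun _ => c) (ψ := ψ)
        (fun t' _ => mem_surface_zero.2 ⟨t', ψ, h, rfl⟩) (.inr tendsto_id) hb
    · exact not_isBounded_of_tendsto (ψ := ψ) (z := fun t' => height a .parabolic c t')
        (fun t' ht' => (mem_surface_zero (w := .parabolic)).2 ⟨t', ψ, ⟨h.1, ht'⟩, rfl⟩)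
        (.inl (Tendsto.const_mul_atTop h.1 tendsto_id)) hb
  · have key : ∀ w : RotWeb, (1, Real.pi / 2) ∈ w.dom → (∃ R, ∀ t,
        w.radial a 1 t ^ 2 + w.height a 1 t ^ 2 ≤ R ^ 2) →
        ∃ S ∈ w.surfaces a, Bornology.IsBounded S := by
      rintro w h ⟨R, hR⟩
      refine ⟨w.surface a 0 1, surface_mem_surfaces
        ⟨_, mem_surface_zero.2 ⟨Real.pi / 2, 0, h, rfl⟩⟩,
        isBounded_iff_forall_norm_le.2 ⟨|R|, fun x hx => ?_⟩⟩
      obtain ⟨t, ψ, -, rfl⟩ := mem_surface_zero.1 hx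
      exact (abs_of_nonneg (norm_nonneg (cyl _ _ _))).symm.trans_le
        (sq_le_sq.1 ((norm_cyl_sq _ _ _).trans_le (hR t)))
    have hdom : (0 : ℝ) < 1 ∧ Real.pi / 2 ∈ Set.Ioo 0 Real.pi :=
      ⟨one_pos, by constructor <;> linarith [Real.pi_pos]⟩
    rintro ⟨h1, h2⟩
    cases w
    · exact absurd rfl h1
    · refine key _ hdom ⟨1, fun t => ?_⟩
      simp [radial, height]
    · exact absurd rfl h2
    · refine key _ hdom ⟨a * Real.cosh 1, fun t => ?_⟩
      simp only [radial, height]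
      nlinarith [Real.cosh_sq 1, Real.sin_sq_add_cos_sq t, sq_nonneg (a * Real.sin t)]
    · refine key _ hdom ⟨a * Real.cosh 1, fun t => ?_⟩
      simp only [radial, height]
      nlinarith [Real.cosh_sq 1, Real.sin_sq_add_cos_sq t, sq_nonneg (a * Real.cos t)]

/-- An ellipsoid of revolution which lies on a sphere has equal semi-axes. -/
lemma sq_eq_sq_of_isSpherical {A B : ℝ}
    (h : IsSpherical {x | ∃ t ψ, t ∈ Set.Ioo 0 Real.pi ∧
      x = cyl (A * Real.sin t) ψ (B * Real.cos t)}) : A ^ 2 = B ^ 2 := by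
  obtain ⟨c, R, h⟩ := h
  have hd : ∀ t ∈ Set.Ioo 0 Real.pi, ∀ ψ, (A * Real.sin t * Real.cos ψ - c 0) ^ 2
      + (A * Real.sin t * Real.sin ψ - c 1) ^ 2 + (B * Real.cos t - c 2) ^ 2 = R ^ 2 := by
    intro t ht ψ
    rw [← dist_cyl_sq, Metric.mem_sphere.1 (h ⟨t, ψ, ht, rfl⟩)]
  have hp := Real.pi_pos
  -- averaging over `ψ ↦ π - ψ` and `t ↦ π - t` removes the centre from the equation
  have h2 : ∀ t ∈ Set.Ioo 0 Real.pi,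
      A ^ 2 * Real.sin t ^ 2 + B ^ 2 * Real.cos t ^ 2
        = R ^ 2 - c 0 ^ 2 - c 1 ^ 2 - c 2 ^ 2 := by
    intro t ht
    have ht' : Real.pi - t ∈ Set.Ioo 0 Real.pi := ⟨by linarith [ht.2], by linarith [ht.1]⟩
    have e1 := hd t ht 0
    have e2 := hd t ht Real.pi
    have e3 := hd _ ht' 0
    have e4 := hd _ ht' Real.pi
    simp only [Real.cos_zero, Real.sin_zero, Real.cos_pi, Real.sin_pi, Real.sin_pi_sub,
      Real.cos_pi_sub] at e1 e2 e3 e4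
    linear_combination (e1 + e2 + e3 + e4) / 4
  have e1 := h2 (Real.pi / 2) ⟨by linarith, by linarith⟩
  have e2 := h2 (Real.pi / 3) ⟨by linarith, by linarith⟩
  rw [Real.sin_pi_div_two, Real.cos_pi_div_two] at e1
  rw [Real.cos_pi_div_three, Real.sin_pi_div_three, div_pow, Real.sq_sqrt (by norm_num)] at e2
  linear_combination 4 * (e1 - e2)

lemma exists_isSpherical_iff {w : RotWeb} {a : ℝ} (ha : 0 < a) :
    (∃ S ∈ w.surfaces a, IsSpherical S) ↔ w = spherical := by
  constructor
  · rintro ⟨_, ⟨hne, i, c, rfl⟩, hs⟩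
    have hb : Bornology.IsBounded (w.surface a i c) := by
      obtain ⟨x, R, h⟩ := hs
      exact Metric.isBounded_sphere.subset h
    obtain rfl : i = 0 := by
      by_contra hi
      exact not_isBounded_surface ha hi hne hb
    have h := (exists_isBounded_iff w ha).1 ⟨_, surface_mem_surfaces hne, hb⟩
    obtain ⟨x, hx⟩ := hne
    obtain ⟨t, ψ, ht, -⟩ := mem_surface_zero.1 hx
    cases w
    · exact absurd rfl h.1
    · rfl
    · exact absurd rfl h.2
    · have := sq_eq_sq_of_isSpherical (A := a * Real.sinh c) (B := a * Real.cosh c) (by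
        obtain ⟨x, R, h⟩ := hs
        refine ⟨x, R, ?_⟩
        rintro _ ⟨t', ψ', ht', rfl⟩
        exact h (mem_surface_zero.2 ⟨t', ψ', ⟨ht.1, ht'⟩, rfl⟩))
      nlinarith [Real.cosh_sq c, pow_pos ha 2]
    · have := sq_eq_sq_of_isSpherical (A := a * Real.cosh c) (B := a * Real.sinh c) (by
        obtain ⟨x, R, h⟩ := hs
        refine ⟨x, R, ?_⟩
        rintro _ ⟨t', ψ', ht', rfl⟩
        exact h (mem_surface_zero.2 ⟨t', ψ', ⟨ht.1, ht'⟩, rfl⟩))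
      nlinarith [Real.cosh_sq c, pow_pos ha 2]
  · rintro rfl
    refine ⟨surface .spherical a 0 1, surface_mem_surfaces
      ⟨_, mem_surface_zero.2 ⟨Real.pi / 2, 0, ?_, rfl⟩⟩, 0, 1, fun x hx => ?_⟩
    · exact ⟨one_pos, by constructor <;> linarith [Real.pi_pos]⟩
    · obtain ⟨t, ψ, -, rfl⟩ := mem_surface_zero.1 hx
      have := norm_cyl_sq (1 * Real.sin t) ψ (1 * Real.cos t)
      rw [mem_sphere_zero_iff_norm, ← sq_eq_sq₀ (norm_nonneg _) zero_le_one]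
      simpa [radial, height] using this

/-- A prolate ellipsoid of the web lacks its two poles, which are the only points at maximal
distance. -/
lemma not_exists_attainsDiam_prolate (ha : 0 < a) :
    ¬ ∃ S ∈ prolate.surfaces a, AttainsDiam S := by
  rintro ⟨_, ⟨hne, i, c, rfl⟩, hb, x, hx, y, hy, h⟩
  obtain rfl : i = 0 := by
    by_contra hi
    exact not_isBounded_surface ha hi hne hb
  have hlt : ∀ u ∈ prolate.surface a 0 c, ‖u‖ < a * Real.cosh c := by
    intro u hu
    obtain ⟨t, ψ, ht, rfl⟩ := mem_surface_zero.1 hu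
    have h1 := norm_cyl_sq (a * Real.sinh c * Real.sin t) ψ (a * Real.cosh c * Real.cos t)
    have h2 : 0 < a * Real.sin t := mul_pos ha (Real.sin_pos_of_mem_Ioo ht.2)
    have h3 : 0 < a * Real.cosh c := mul_pos ha (Real.cosh_pos c)
    refine lt_of_pow_lt_pow_left₀ 2 h3.le (h1.trans_lt ?_)
    nlinarith [Real.cosh_sq c, Real.sin_sq_add_cos_sq t, pow_pos h2 2]
  obtain ⟨t₀, ψ, ht₀, -⟩ := mem_surface_zero.1 hx
  have hd : dist x y < 2 * (a * Real.cosh c * Real.cos 0) := by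
    rw [dist_eq_norm, Real.cos_zero]
    linarith [norm_sub_le x y, hlt x hx, hlt y hy]
  have hcont : Continuous fun t => 2 * (a * Real.cosh c * Real.cos t) := by fun_prop
  have hev : ∀ᶠ t in 𝓝[>] (0 : ℝ), dist x y < 2 * (a * Real.cosh c * Real.cos t) :=
    (hcont.continuousAt.eventually_const_lt hd).filter_mono nhdsWithin_le_nhds
  obtain ⟨t, ht, htI⟩ := (hev.and (Ioo_mem_nhdsGT Real.pi_pos)).exists
  have htI' : Real.pi - t ∈ Set.Ioo 0 Real.pi := ⟨by linarith [htI.2], by linarith [htI.1]⟩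
  have h1 := h _ (mem_surface_zero.2 ⟨t, 0, ⟨ht₀.1, htI⟩, rfl⟩)
    _ (mem_surface_zero.2 ⟨Real.pi - t, 0, ⟨ht₀.1, htI'⟩, rfl⟩)
  have h2 := dist_cyl_sq (prolate.radial a c t) 0 (prolate.height a c t)
    (cyl (prolate.radial a c (Real.pi - t)) 0 (prolate.height a c (Real.pi - t)))
  simp only [cyl_apply_zero, cyl_apply_one, cyl_apply_two, radial, height, Real.sin_pi_sub,
    Real.cos_pi_sub] at h1 h2
  nlinarith [pow_le_pow_left₀ dist_nonneg h1 2, dist_nonneg (x := x) (y := y)]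

lemma exists_attainsDiam_oblate (ha : 0 < a) : ∃ S ∈ oblate.surfaces a, AttainsDiam S := by
  have hdom : ((1 : ℝ), Real.pi / 2) ∈ oblate.dom :=
    ⟨one_pos, by constructor <;> linarith [Real.pi_pos]⟩
  have hle : ∀ u ∈ oblate.surface a 0 1, ‖u‖ ≤ a * Real.cosh 1 := by
    intro u hu
    obtain ⟨t, ψ, ht, rfl⟩ := mem_surface_zero.1 hu
    have h1 := norm_cyl_sq (a * Real.cosh 1 * Real.sin t) ψ (a * Real.sinh 1 * Real.cos t)
    have h3 : 0 < a * Real.cosh 1 := mul_pos ha (Real.cosh_pos 1)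
    refine le_of_sq_le_sq (h1.trans_le ?_) h3.le
    nlinarith [Real.cosh_sq 1, Real.sin_sq_add_cos_sq t, sq_nonneg (a * Real.cos t)]
  have hmem := fun ψ => mem_surface_zero (w := oblate) (a := a).2 ⟨Real.pi / 2, ψ, hdom, rfl⟩
  refine ⟨oblate.surface a 0 1, surface_mem_surfaces ⟨_, hmem 0⟩,
    isBounded_iff_forall_norm_le.2 ⟨_, hle⟩, _, hmem 0, _, hmem Real.pi, fun u hu v hv => ?_⟩
  rw [dist_eq_norm u v]
  refine (norm_sub_le u v).trans ((add_le_add (hle u hu) (hle v hv)).trans ?_)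
  refine le_of_sq_le_sq ?_ dist_nonneg
  rw [dist_cyl_sq]
  simp [radial, height]

lemma exists_isPartlyRuled_cylindrical (a : ℝ) :
    ∃ S ∈ cylindrical.surfaces a, IsPartlyRuled S := by
  have hmem : ∀ ψ z, cyl 1 ψ z ∈ cylindrical.surface a 0 1 := fun ψ z =>
    mem_surface_zero.2 ⟨z, ψ, (one_pos : (0 : ℝ) < 1), rfl⟩
  refine ⟨_, surface_mem_surfaces ⟨_, hmem 0 0⟩,
    ⟨_, hmem 0 0, _, hmem Real.pi 0, fun h => ?_⟩, _, hmem 0 0, _, hmem 0 2, fun h => ?_, ?_⟩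
  · obtain ⟨t, ψ, -, h⟩ := mem_surface_zero.1 h
    have h0 := congrArg (fun x : E3 => x 0) h
    have h1 := congrArg (fun x : E3 => x 1) h
    simp only [midpoint_apply_coord, cyl_apply_zero, cyl_apply_one, Real.cos_zero, Real.cos_pi,
      Real.sin_zero, Real.sin_pi, radial] at h0 h1
    nlinarith [Real.sin_sq_add_cos_sq ψ]
  · have h2 := congrArg (fun x : E3 => x 2) h
    simp at h2
  · rw [midpoint_cyl]
    norm_num [hmem]

/-- A paraboloid of revolution contains no three points in arithmetic progression. -/
lemma eq_of_midpoint_mem_paraboloid {α β : ℝ} (hβ : β ≠ 0) {S : Set E3}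
    (hS : ∀ x ∈ S, x 0 ^ 2 + x 1 ^ 2 = α + β * x 2) {x y : E3} (hx : x ∈ S) (hy : y ∈ S)
    (h : midpoint ℝ x y ∈ S) : x = y := by
  have h1 := hS x hx
  have h2 := hS y hy
  have h3 := hS _ h
  simp only [midpoint_apply_coord] at h3
  have h4 : (x 0 - y 0) ^ 2 + (x 1 - y 1) ^ 2 = 0 := by
    linear_combination 2 * h1 + 2 * h2 - 4 * h3
  have h0 : x 0 = y 0 := by nlinarith [sq_nonneg (x 0 - y 0), sq_nonneg (x 1 - y 1)]
  have h0' : x 1 = y 1 := by nlinarith [sq_nonneg (x 0 - y 0), sq_nonneg (x 1 - y 1)]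
  have h5 : x 2 = y 2 := mul_left_cancel₀ hβ (by rw [h0, h0'] at h1; linarith)
  ext i
  obtain rfl | rfl | rfl : i = 0 ∨ i = 1 ∨ i = 2 := by omega
  exacts [h0, h0', h5]

lemma cyl_mem_parabolic_surface_two {r : ℝ} (hr : 0 < r) (z : ℝ) :
    cyl r c z ∈ parabolic.surface a 2 c := by
  -- `s² = √(r² + z²) + z` and `t² = √(r² + z²) - z`
  have hz : |z| < √(r ^ 2 + z ^ 2) := Real.lt_sqrt_of_sq_lt (by rw [sq_abs]; nlinarith)
  obtain ⟨h1, h2⟩ := abs_lt.1 hz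
  have hR := Real.sq_sqrt (show 0 ≤ r ^ 2 + z ^ 2 by positivity)
  set R := √(r ^ 2 + z ^ 2)
  refine mem_surface_two.2 ⟨√(R + z), √(R - z), ⟨Real.sqrt_pos.2 (by linarith),
    Real.sqrt_pos.2 (by linarith)⟩, ?_⟩
  simp only [radial, height]
  rw [Real.sq_sqrt (by linarith), Real.sq_sqrt (by linarith), ← Real.sqrt_mul (by linarith),
    show (R + z) * (R - z) = r ^ 2 by linear_combination hR, Real.sqrt_sq hr.le]
  congr 1
  ring

lemma not_exists_isPartlyRuled_parabolic (a : ℝ) :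
    ¬ ∃ S ∈ parabolic.surfaces a, IsPartlyRuled S := by
  rintro ⟨_, ⟨-, i, c, rfl⟩, ⟨x, hx, y, hy, hxy⟩, u, hu, v, hv, hne, huv⟩
  obtain rfl | rfl | rfl : i = 0 ∨ i = 1 ∨ i = 2 := by omega
  · obtain ⟨_, _, ⟨hc, -⟩, -⟩ := mem_surface_zero.1 hx
    refine hne (eq_of_midpoint_mem_paraboloid (α := c ^ 4) (β := -(2 * c ^ 2)) ?_ ?_ hu hv huv)
    · exact neg_ne_zero.2 (mul_ne_zero two_ne_zero (pow_ne_zero 2 (ne_of_gt hc)))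
    · intro p hp
      obtain ⟨t, ψ, -, rfl⟩ := mem_surface_zero.1 hp
      simp only [cyl_apply_zero, cyl_apply_one, cyl_apply_two, radial, height]
      linear_combination (c * t) ^ 2 * Real.sin_sq_add_cos_sq ψ
  · obtain ⟨_, _, ⟨-, hc⟩, -⟩ := mem_surface_one.1 hx
    refine hne (eq_of_midpoint_mem_paraboloid (α := c ^ 4) (β := 2 * c ^ 2) ?_ ?_ hu hv huv)
    · exact mul_ne_zero two_ne_zero (pow_ne_zero 2 (ne_of_gt hc))
    · intro p hp
      obtain ⟨s, ψ, -, rfl⟩ := mem_surface_one.1 hp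
      simp only [cyl_apply_zero, cyl_apply_one, cyl_apply_two, radial, height]
      linear_combination (c * s) ^ 2 * Real.sin_sq_add_cos_sq ψ
  · obtain ⟨s, t, h, rfl⟩ := mem_surface_two.1 hx
    obtain ⟨s', t', h', rfl⟩ := mem_surface_two.1 hy
    rw [midpoint_cyl] at hxy
    exact hxy (cyl_mem_parabolic_surface_two
      (half_pos (add_pos (mul_pos h.1 h.2) (mul_pos h'.1 h'.2))) _)

lemma not_webEquiv {w w' : RotWeb} {a b : ℝ} (ha : 0 < a) (hb : 0 < b) (hw : w ≠ w') :
    ¬ WebEquiv (w.surfaces a) (w'.surfaces b) := by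
  intro h
  have h1 := (exists_isBounded_iff w ha).symm.trans
    ((h.exists_iff isBounded_image_dilation).trans (exists_isBounded_iff w' hb))
  have h2 := (exists_isSpherical_iff (w := w) ha).symm.trans
    ((h.exists_iff IsSpherical.image).trans (exists_isSpherical_iff (w := w') hb))
  have h3 := h.exists_iff AttainsDiam.image
  have h4 := h.exists_iff IsPartlyRuled.image
  cases w <;> cases w' <;> first
    | exact hw rfl
    | (simp at h1; done)
    | (simp at h2; done)
    | exact not_exists_isPartlyRuled_parabolic _ (h4.1 (exists_isPartlyRuled_cylindrical _))
    | exact not_exists_isPartlyRuled_parabolic _ (h4.2 (exists_isPartlyRuled_cylindrical _))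
    | exact not_exists_attainsDiam_prolate hb (h3.1 (exists_attainsDiam_oblate ha))
    | exact not_exists_attainsDiam_prolate ha (h3.2 (exists_attainsDiam_oblate hb))

end RotWeb

theorem theorem5 (F : ℝ → ℝ) (D : Set ℝ)
    (hper : Function.Periodic F (2 * Real.pi))
    (hD : IsOpen D) (hne : D.Nonempty) (hF : ContDiffOn ℝ ∞ F D) :
    -- the classical first integrals and their Killing tensors
    (∀ k : Fin 5, IsKillingTensor (killing k) ∧
      ∀ x ∈ region D, ∀ p : E3,
        firstIntegral F k x p
          = 1 / 2 * ∑ i : Fin 3, ∑ j : Fin 3, killing k x i j * p i * p j + pot F k x ∧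
        poisson (firstIntegral F 0) (firstIntegral F k) x p = 0) ∧
    -- four second order operators commuting with the Schrödinger operator
    (∀ k : Fin 5, IsSecondOrderOn (region D) (qop F k)) ∧
    (∀ k : Fin 5, k ≠ 0 → CommuteOn (region D) (qop F 0) (qop F k)) ∧
    -- they are distinct, even linearly independent together with the Schrödinger operator
    LinIndepOn (region D) (qop F) ∧
    -- multiplicative separability in the five types of rotational webs
    (∀ (w : RotWeb) (a : ℝ), 0 < a →
      IsOrthogonalCoords (w.coord a) (w.coordDom D) ∧
      MultiplicativelySeparable (qop F 0) (w.coord a) (w.coordDom D)) ∧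
    -- the five webs are distinct
    (∀ (w w' : RotWeb) (a b : ℝ), 0 < a → 0 < b → w ≠ w' →
      ¬ WebEquiv (w.surfaces a) (w'.surfaces b)) := by
  have hpot := contDiffOn_pot hper hD hF
  refine ⟨fun k => ⟨isKillingTensor_killing k, fun x hx p => ⟨firstIntegral_eq F k
    (rad_pos_of_mem hx) p, ?_⟩⟩, isSecondOrderOn_qop F hD hne, fun k hk => ?_,
    linIndepOn_qop F hne, fun w a ha => ?_, fun w w' a b ha hb hw => RotWeb.not_webEquiv ha hb hw⟩
  · exact poisson_firstIntegral F k (isOpen_region hD) (fun x => rad_pos_of_mem) (hpot 0) (hpot k)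
      hx p
  · exact commuteOn_qop hD hpot hk
  · obtain ⟨P⟩ := w.nonempty_separableProfile ha
    exact ⟨P.isOrthogonalCoords hD, P.multiplicativelySeparable hper hF⟩
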